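/- **Model.** Let $k\ge 2$, stress levels $x_1<\dots<x_k$ (real), and inspection times $0=t_0<t_1<\dots<t_L$. Let $0=l_0<l_1<\dots<l_k=L$ be integers and put $\tau_i=t_{l_i}$; the stress is raised from $x_i$ to $x_{i+1}$ at time $\tau_i$ ($1\le i<k$) and the test ends at $\tau_k=t_L$. For $\theta=(\theta_0,\theta_1)\in\Theta=(0,\infty)\times\mathbb R$ let $\lambda_i(\theta)=\theta_0e^{\theta_1x_i}$ and, for $1\le i\le k$, $$a_{i-1}=\frac{1}{\lambda_i}\sum_{l=1}^{i-1}(\tau_l-\tau_{l-1})\lambda_l,\qquad a^*_{i-1}=\frac1{\lambda_i}\sum_{l=1}^{i-1}\lambda_l(\tau_l-\tau_{l-1})(x_l-x_i).$$ Under the cumulative exposure model with exponential lifetimes, the lifetime has distribution function $G_T(t)=1-e^{-\lambda_i(t+a_{i-1}-\tau_{i-1})}$ and density $g_T(t)=\lambda_ie^{-\lambda_i(t+a_{i-1}-\tau_{i-1})}$ for $\tau_{i-1}\le t<\tau_i$, $t>0$ (for $\tau_{k-1}\le t<\infty$ if $i=k$), and $G_T(0)=0$. Let $\pi_j(\theta)=G_T(t_j)-G_T(t_{j-1})$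 for $1\le j\le L$ and $\pi_{L+1}(\theta)=1-G_T(t_L)$. Let $W=W(\theta)$ be the $(L+1)\times2$ matrix with rows $z_j-z_{j-1}$, $1\le j\le L+1$, where $z_0=z_{L+1}=0$ and, for $1\le j\le L$, $$z_j=g_T(t_j)\Bigl(\tfrac{t_j+a_{i-1}-\tau_{i-1}}{\theta_0},\ (t_j+a_{i-1}-\tau_{i-1})x_i+a^*_{i-1}\Bigr)^T,$$ $i$ being the stress level used at $t_j$ in the formula for $G_T$. **Estimators.** Let $\theta_0\in\Theta$ (a vector) be the true parameter. For each $N$ let the counts $(n_1,\dots,n_{L+1})$ be multinomial with $N$ trials and probability vector $\pi(\theta_0)$, and let $\hat p=(n_1/N,\dots,n_{L+1}/N)$. For probability vectors $p,q$ let $$d_\beta(p,q)=\sum_{j=1}^{L+1}\Bigl(q_j^{1+\beta}-\bigl(1+\tfrac1\beta\bigr)p_jq_j^{\beta}+\tfrac1\beta p_j^{\beta+1}\Bigr)\ (\beta>0),\qquad d_0(p,q)=\sum_{j=1}^{L+1}p_j\log\frac{p_j}{q_j}.$$ A minimum DPD estimator $\hat\theta^\beta=\hat\theta^\beta_N$ is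 a random vector that is a global minimizer of $\theta\mapsto d_\beta(\hat p,\pi(\theta))$ over $\Theta$ whenever a minimizer exists (and is arbitrary otherwise). An MLE is, in the same way, a global maximizer over $\Theta$ of the likelihood $\frac{N!}{n_1!\cdots n_{L+1}!}\prod_j\pi_j(\theta)^{n_j}$. **Theorem.** Let $\beta\ge0$. Then a minimizer exists with probability tending to $1$ as $N\to\infty$, and for every sequence of minimum DPD estimators $$\sqrt N\,(\hat\theta^\beta-\theta_0)\ \longrightarrow\ \mathcal N\bigl(0,\ J_\beta^{-1}(\theta_0)K_\beta(\theta_0)J_\beta^{-1}(\theta_0)\bigr)\quad\text{in distribution},$$ where $$J_\beta(\theta_0)=W^TD_{\pi(\theta_0)}^{\beta-1}W,\qquad K_\beta(\theta_0)=W^T\bigl(D_{\pi(\theta_0)}^{2\beta-1}-\pi(\theta_0)^\beta(\pi(\theta_0)^{\beta})^T\bigr)W,$$ $W=W(\theta_0)$, $D_{\pi}$ is the diagonal matrix with entries $\pi_j$ and $\pi^\beta$ is the vector with entries $\pi_j^\beta$; the matrix $J_\beta(\theta_0)$ is invertible and the limiting covariance matrix is positive semidefinite. Moreover $J_0(\theta_0)=K_0(\theta_0)=I_F(\theta_0)=W^TD_{\pi(\theta_0)}^{-1}W$,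 where $I_F(\theta)=\sum_j\pi_j(\theta)\,\nabla\log\pi_j(\theta)\,\nabla\log\pi_j(\theta)^T$ is the Fisher information matrix of one device; a maximizer of the likelihood exists with probability tending to $1$, and every sequence of MLEs satisfies $\sqrt N\,(\hat\theta^{MLE}-\theta_0)\to\mathcal N(0,I_F^{-1}(\theta_0))$ in distribution. -/

import Mathlib

open scoped Matrix Topology

noncomputable section

namespace StepStress

/-- The design of a multiple step-stress accelerated life test with `k ≥ 2` ordered stress levels
`x 1 < ⋯ < x k` and `L` inspection times `0 < t 1 < ⋯ < t L`.
The `i`-th time of stress change is the `l i`-th inspection time, `τ i = t (l i)`, and the test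
terminates at `τ k = t L`. Only the values `x 1, …, x k`, `t 0, …, t L`, `l 0, …, l k` matter. -/
structure Design where
  k : ℕ
  L : ℕ
  x : ℕ → ℝ
  t : ℕ → ℝ
  l : ℕ → ℕ
  two_le_k : 2 ≤ k
  x_strictMono : StrictMonoOn x (Set.Icc 1 k)
  t_zero : t 0 = 0
  t_strictMono : StrictMonoOn t (Set.Icc 0 L)
  l_zero : l 0 = 0
  l_last : l k = L
  l_strictMono : StrictMonoOn l (Set.Icc 0 k)

/-- The parameter space `Θ = (0, ∞) × ℝ` of `θ = (θ₀, θ₁)`. -/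
def paramSpace : Set (EuclideanSpace ℝ (Fin 2)) := {θ | 0 < θ 0}

namespace Design

variable (D : Design) (θ : EuclideanSpace ℝ (Fin 2))

/-- The times of stress change `τ_1 < ⋯ < τ_k`, with `τ_0 = 0`. -/
def tau (i : ℕ) : ℝ := D.t (D.l i)

/-- The log-linear failure rate `λ_i(θ) = θ₀ exp (θ₁ x_i)` at the `i`-th stress level. -/
def rate (i : ℕ) : ℝ := θ 0 * Real.exp (θ 1 * D.x i)

/-- The shift `a_{i-1} = (∑_{l=1}^{i-1} (τ_l - τ_{l-1}) λ_l) / λ_i` of the cumulative exposure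
model, indexed by the stress level `i = 1, …, k`; it vanishes for `i = 1`. -/
def shift (i : ℕ) : ℝ :=
  (∑ m ∈ Finset.Icc 1 (i - 1), (D.tau m - D.tau (m - 1)) * D.rate θ m) / D.rate θ i

/-- The quantity `a*_{i-1} = (1 / λ_i) ∑_{l=1}^{i-1} λ_l (τ_l - τ_{l-1}) (-x_i + x_l)`, indexed by
the stress level `i = 1, …, k`. -/
def shiftStar (i : ℕ) : ℝ :=
  1 / D.rate θ i *
    ∑ m ∈ Finset.Icc 1 (i - 1), D.rate θ m * (D.tau m - D.tau (m - 1)) * (-D.x i + D.x m)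

/-- The stress level in force at and right after time `s`: it is `1` before `τ_1`, it is `i` on
`[τ_{i-1}, τ_i)` for `1 < i < k`, and it is `k` from `τ_{k-1}` on. -/
def level (s : ℝ) : ℕ := 1 + ((Finset.Icc 1 (D.k - 1)).filter fun i => D.tau i ≤ s).card

/-- The equivalent age `s + a_{i-1} - τ_{i-1}` at time `s`, where `i` is the level at time `s`. -/
def age (s : ℝ) : ℝ := s + D.shift θ (D.level s) - D.tau (D.level s - 1)

/-- The distribution function `G_T` of the lifetime under the cumulative exposure model with
exponential lifetimes. -/
def lifetimeCDF (s : ℝ) : ℝ :=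
  if 0 < s then 1 - Real.exp (-(D.rate θ (D.level s) * D.age θ s)) else 0

/-- The density `g_T` of the lifetime. -/
def lifetimeDensity (s : ℝ) : ℝ :=
  if 0 < s then D.rate θ (D.level s) * Real.exp (-(D.rate θ (D.level s) * D.age θ s)) else 0

/-- The cell probabilities. The cell with index `j < L` is the failure in `(t_j, t_{j+1}]`; the
last cell, with index `L`, is the survival of the test. -/
def prob (j : Fin (D.L + 1)) : ℝ :=
  if (j : ℕ) < D.L then D.lifetimeCDF θ (D.t (j + 1)) - D.lifetimeCDF θ (D.t j)
  else 1 - D.lifetimeCDF θ (D.t D.L)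

/-- The vectors `z_j`: for `1 ≤ j ≤ L`,
`z_j = g_T(t_j) ((t_j + a_{i-1} - τ_{i-1}) / θ₀, (t_j + a_{i-1} - τ_{i-1}) x_i + a*_{i-1})`
with `i` the stress level in force after time `t_j`; `z_0 = z_{L+1} = 0`. -/
def z (j : ℕ) : Fin 2 → ℝ :=
  if 1 ≤ j ∧ j ≤ D.L then
    D.lifetimeDensity θ (D.t j) •
      ![D.age θ (D.t j) / θ 0,
        D.age θ (D.t j) * D.x (D.level (D.t j)) + D.shiftStar θ (D.level (D.t j))]
  else 0

/-- The `(L + 1) × 2` matrix `W` with rows `z_j - z_{j-1}`, `j = 1, …, L + 1`. -/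
def W : Matrix (Fin (D.L + 1)) (Fin 2) ℝ :=
  Matrix.of fun j => D.z θ (j + 1) - D.z θ j

/-- `J_β(θ) = Wᵀ D_π^{β-1} W`. -/
def J (β : ℝ) : Matrix (Fin 2) (Fin 2) ℝ :=
  (D.W θ)ᵀ * Matrix.diagonal (fun j => D.prob θ j ^ (β - 1)) * D.W θ

/-- `K_β(θ) = Wᵀ (D_π^{2β-1} - π^β (π^β)ᵀ) W`. -/
def K (β : ℝ) : Matrix (Fin 2) (Fin 2) ℝ :=
  (D.W θ)ᵀ *
    (Matrix.diagonal (fun j => D.prob θ j ^ (2 * β - 1)) -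
      Matrix.vecMulVec (fun j => D.prob θ j ^ β) (fun j => D.prob θ j ^ β)) *
    D.W θ

/-- The score `∂ log π_j(θ) / ∂θ` of a single device that falls in cell `j`. -/
def score (j : Fin (D.L + 1)) : Fin 2 → ℝ := fun a =>
  fderiv ℝ (fun η => Real.log (D.prob η j)) θ (EuclideanSpace.single a 1)

/-- The Fisher information matrix of a single device: the second moment matrix of the score. -/
def fisherInformation : Matrix (Fin 2) (Fin 2) ℝ :=
  ∑ j, D.prob θ j • Matrix.vecMulVec (D.score θ j) (D.score θ j)

/-- The likelihood `N! / (n_1! ⋯ n_{L+1}!) ∏ π_j(θ) ^ n_j` of the counts `n`, `N = ∑ n_j`. -/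
def likelihood (n : Fin (D.L + 1) → ℕ) : ℝ :=
  (Nat.multinomial Finset.univ n : ℝ) * ∏ j, D.prob θ j ^ n j

/-- The multinomial law of the counts for `N` devices and cell probabilities `π(θ)`. -/
def countLaw (N : ℕ) : MeasureTheory.Measure (Fin (D.L + 1) → ℕ) :=
  ∑ n ∈ Finset.piAntidiag Finset.univ N,
    ENNReal.ofReal (D.likelihood θ n) • MeasureTheory.Measure.dirac n

end Design

/-- The empirical probability vector `(n_1 / N, …, n_m / N)`. -/
def empirical {m : ℕ} (N : ℕ) (n : Fin m → ℕ) : Fin m → ℝ := fun j => (n j : ℝ) / N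

/-- The density power divergence `d_β(p, q)` between two probability vectors, for `β ≥ 0`; at
`β = 0` it is the Kullback-Leibler divergence. -/
def dpd {m : ℕ} (β : ℝ) (p q : Fin m → ℝ) : ℝ :=
  if β = 0 then ∑ j, p j * Real.log (p j / q j)
  else ∑ j, (q j ^ (1 + β) - (1 + 1 / β) * p j * q j ^ β + 1 / β * p j ^ (β + 1))

/-- `θ` is a minimum density power divergence estimate for the empirical probabilities `p`: a
global minimizer of `d_β(p, π(·))` over the parameter space. -/
def Design.IsMDPDE (D : Design) (β : ℝ) (p : Fin (D.L + 1) → ℝ)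
    (θ : EuclideanSpace ℝ (Fin 2)) : Prop :=
  θ ∈ paramSpace ∧ IsMinOn (fun η => dpd β p (D.prob η)) paramSpace θ

/-- `θ` is a maximum likelihood estimate for the counts `n`: a global maximizer of the likelihood
over the parameter space. -/
def Design.IsMLE (D : Design) (n : Fin (D.L + 1) → ℕ) (θ : EuclideanSpace ℝ (Fin 2)) : Prop :=
  θ ∈ paramSpace ∧ IsMaxOn (fun η => D.likelihood η n) paramSpace θ

end StepStress

end

open MeasureTheory ProbabilityTheory Filter StepStress

/-!
The cell probabilities depend on `θ` only through the cumulative hazards `H_j` at the inspection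
times: with `S_j = exp (-H_j)` and `S_{L+1} = 0` they are `S_j - S_{j+1}`. Each `H_j` is smooth in
`θ` and grows between inspections at the failure rate then in force. So the probabilities are
positive and smooth, `W` is their Jacobian (`fderiv_cellProb_apply`), and the failure rates at the
lowest and at the highest stress, hence `θ` itself, are smooth functions of the probabilities
(`recover_cellProb`). This left inverse gives identifiability, injectivity of `W`, and the
compactness behind the existence of estimates.

The statistical argument is a delta method. Its deterministic half says that the map from a
probability vector `p` to a minimizer of `d_β(p, π(·))` is differentiable at `π(θ₀)`:

* the divergence separates probability vectors uniformly (`eventually_dist_le_of_dpd_le`), so for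
  `p` near `π(θ₀)` only parameters in a compact set compete with `θ₀`; a minimizer exists
  (`eventually_exists_isMDPDE`), and every minimizer is near `θ₀` (`tendsto_snd_mdpdeFilter`);
* a minimizer is a critical point, `Wᵀ D_π^{β-1} (π(θ) - p) = 0` with `W` and `π` taken at `θ`
  (`IsMDPDE.scoreMap_eq_zero`);
* linearized at `θ₀` the equation reads `J_β (θ - θ₀) = Wᵀ D_π^{β-1} (p - π(θ₀)) + o(p - π(θ₀))`
  (`isLittleO_mdpde`).

The probabilistic half is the central limit theorem for the empirical frequencies
(`tendstoInDistribution_empirical`). By the multinomial theorem their characteristic function is an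
`N`-th power, and Lévy's continuity theorem applies. Slutsky's theorem joins the two halves
(`tendstoInDistribution_mdpde`). Maximum likelihood is the case `β = 0` (`isMLE_iff`).
-/

/-! ### Cell probabilities of the step-stress model -/

namespace StepStress

namespace Design

variable (D : Design) (θ : EuclideanSpace ℝ (Fin 2))

/-- The cumulative hazard at the inspection time `t_j`, written without division by a failure rate;
this makes it a smooth function on the whole plane. -/
noncomputable def cumHazard (j : ℕ) : ℝ :=
  ∑ m ∈ Finset.Icc 1 (D.level (D.t j) - 1), (D.tau m - D.tau (m - 1)) * D.rate θ m +
    D.rate θ (D.level (D.t j)) * (D.t j - D.tau (D.level (D.t j) - 1))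

/-- The probability of surviving beyond `t_j`, with the convention that it vanishes for `j > L`:
this makes the last cell a difference like the others. -/
noncomputable def survival (j : ℕ) : ℝ := if j ≤ D.L then Real.exp (-D.cumHazard θ j) else 0

/-- The cell probabilities as differences of the survival function. They agree with `prob` on the
parameter space and are smooth on the whole plane. -/
noncomputable def cellProb (j : Fin (D.L + 1)) : ℝ := D.survival θ j - D.survival θ (j + 1)

variable {θ}

lemma rate_pos (hθ : θ ∈ paramSpace) (i : ℕ) : 0 < D.rate θ i :=
  mul_pos hθ (Real.exp_pos _)

lemma one_le_L : 1 ≤ D.L := by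
  have h := D.l_strictMono (a := 0) (b := D.k) (by simp) (by simp) (by linarith [D.two_le_k])
  rw [D.l_zero, D.l_last] at h
  exact h

lemma l_le_L {i : ℕ} (hi : i ≤ D.k) : D.l i ≤ D.L := by
  rw [← D.l_last]
  exact D.l_strictMono.monotoneOn (by simp [hi]) (by simp) hi

lemma tau_le_t_iff {i j : ℕ} (hi : i ≤ D.k) (hj : j ≤ D.L) : D.tau i ≤ D.t j ↔ D.l i ≤ j :=
  D.t_strictMono.le_iff_le (by simp [D.l_le_L hi]) (by simp [hj])

lemma tau_zero : D.tau 0 = 0 := by simp [tau, D.l_zero, D.t_zero]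

lemma t_pos {j : ℕ} (hj : 1 ≤ j) (hj' : j ≤ D.L) : 0 < D.t j := by
  rw [← D.t_zero]
  exact D.t_strictMono (by simp) (by simp [hj']) hj

lemma t_lt_succ {j : ℕ} (hj : j < D.L) : D.t j < D.t (j + 1) :=
  D.t_strictMono (by simp; omega) (by simp; omega) (by omega)

/-- The level in force at an inspection time, read off from the indices of the times of stress
change. -/
lemma level_t_eq {i j : ℕ} (hi : 1 ≤ i) (hik : i ≤ D.k) (hj : j ≤ D.L) (h1 : D.l (i - 1) ≤ j)
    (h2 : i < D.k → j < D.l i) : D.level (D.t j) = i := by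
  have : (Finset.Icc 1 (D.k - 1)).filter (fun i => D.tau i ≤ D.t j) = Finset.Icc 1 (i - 1) := by
    ext m
    simp only [Finset.mem_filter, Finset.mem_Icc]
    constructor
    · rintro ⟨⟨hm1, hm2⟩, hm⟩
      rw [D.tau_le_t_iff (by omega) hj] at hm
      refine ⟨hm1, ?_⟩
      by_contra hlt
      have hle : D.l i ≤ D.l m :=
        D.l_strictMono.monotoneOn (by simp; omega) (by simp; omega) (by omega)
      have := h2 (by omega)
      omega
    · rintro ⟨hm1, hm2⟩
      refine ⟨⟨hm1, by omega⟩, ?_⟩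
      rw [D.tau_le_t_iff (by omega) hj]
      exact (D.l_strictMono.monotoneOn (by simp; omega) (by simp; omega) hm2).trans h1
  rw [level, this]
  simp
  omega

lemma exists_level (j : ℕ) :
    ∃ i, 1 ≤ i ∧ i ≤ D.k ∧ D.l (i - 1) ≤ j ∧ (i < D.k → j < D.l i) := by
  have hk := D.two_le_k
  refine ⟨Nat.findGreatest (fun m => D.l m ≤ j) (D.k - 1) + 1, by omega, ?_, ?_, ?_⟩
  · have := Nat.findGreatest_le (P := fun m => D.l m ≤ j) (D.k - 1)
    omega
  · exact Nat.findGreatest_spec (P := fun m => D.l m ≤ j) (m := 0) (by omega) (by simp [D.l_zero])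
  · intro h
    by_contra hlt
    exact Nat.findGreatest_is_greatest (P := fun m => D.l m ≤ j) (n := D.k - 1) (lt_add_one _)
      (by omega) (by omega)

lemma level_t_zero : D.level (D.t 0) = 1 := by
  have hk := D.two_le_k
  refine D.level_t_eq le_rfl (by omega) (by omega) (by simp [D.l_zero]) fun _ => ?_
  have := D.l_strictMono (a := 0) (b := 1) (by simp) (by simp; omega) (by norm_num)
  omega

lemma level_t_last : D.level (D.t (D.L - 1)) = D.k := by
  have hk := D.two_le_k
  have h := D.l_strictMono (a := D.k - 1) (b := D.k) (by simp) (by simp) (by omega)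
  rw [D.l_last] at h
  exact D.level_t_eq (by omega) le_rfl (by omega) (by omega) fun h => by omega

/-- Over the interval from `t_j` to `t_{j+1}` the cumulative hazard grows at the rate in force at
`t_j`, because the stress changes only at inspection times. -/
lemma cumHazard_succ (θ : EuclideanSpace ℝ (Fin 2)) {j : ℕ} (hj : j < D.L) :
    D.cumHazard θ (j + 1) =
      D.cumHazard θ j + D.rate θ (D.level (D.t j)) * (D.t (j + 1) - D.t j) := by
  obtain ⟨i, hi, hik, h1, h2⟩ := D.exists_level j
  have hlev := D.level_t_eq hi hik hj.le h1 h2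
  by_cases h : i < D.k ∧ j + 1 = D.l i
  · -- the stress changes at `t_{j+1}`
    have hlt := D.l_strictMono (a := i) (b := i + 1) (by simp; omega) (by simp; omega) (by omega)
    have hlev' : D.level (D.t (j + 1)) = i + 1 :=
      D.level_t_eq (by omega) (by omega) (by omega) (by simp; omega) fun _ => by omega
    have htau : D.tau i = D.t (j + 1) := by rw [tau, h.2]
    have hIcc : Finset.Icc 1 i = insert i (Finset.Icc 1 (i - 1)) := by
      ext m; simp; omega
    rw [cumHazard, cumHazard, hlev, hlev', Nat.add_sub_cancel, hIcc,
      Finset.sum_insert (by simp; omega), htau]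
    ring
  · have hlev' : D.level (D.t (j + 1)) = i :=
      D.level_t_eq hi hik (by omega) (by omega) fun h' => by
        have := h2 h'
        have : j + 1 ≠ D.l i := fun e => h ⟨h', e⟩
        omega
    rw [cumHazard, cumHazard, hlev, hlev']
    ring

lemma cumHazard_zero (θ : EuclideanSpace ℝ (Fin 2)) : D.cumHazard θ 0 = 0 := by
  rw [cumHazard, level_t_zero]
  simp [D.tau_zero, D.t_zero]

lemma cumHazard_one (θ : EuclideanSpace ℝ (Fin 2)) :
    D.cumHazard θ 1 = D.rate θ 1 * D.t 1 := by
  have := D.cumHazard_succ θ (j := 0) D.one_le_L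
  rwa [D.cumHazard_zero, D.level_t_zero, D.t_zero, zero_add, sub_zero, zero_add] at this

lemma cumHazard_last (θ : EuclideanSpace ℝ (Fin 2)) :
    D.cumHazard θ D.L = D.cumHazard θ (D.L - 1) + D.rate θ D.k * (D.t D.L - D.t (D.L - 1)) := by
  have h := D.one_le_L
  have := D.cumHazard_succ θ (j := D.L - 1) (by omega)
  rwa [D.level_t_last, Nat.sub_add_cancel h] at this

lemma cumHazard_lt_succ (hθ : θ ∈ paramSpace) {j : ℕ} (hj : j < D.L) :
    D.cumHazard θ j < D.cumHazard θ (j + 1) := by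
  rw [D.cumHazard_succ θ hj]
  linarith [mul_pos (D.rate_pos hθ (D.level (D.t j))) (sub_pos.2 (D.t_lt_succ hj))]

lemma rate_mul_shift (hθ : θ ∈ paramSpace) (i : ℕ) :
    D.rate θ i * D.shift θ i =
      ∑ m ∈ Finset.Icc 1 (i - 1), (D.tau m - D.tau (m - 1)) * D.rate θ m := by
  rw [shift, mul_div_cancel₀ _ (D.rate_pos hθ i).ne']

/-- In the cumulative exposure model the hazard accumulated so far is the equivalent age times the
present failure rate. -/
lemma rate_mul_age (hθ : θ ∈ paramSpace) (j : ℕ) :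
    D.rate θ (D.level (D.t j)) * D.age θ (D.t j) = D.cumHazard θ j := by
  rw [cumHazard, ← D.rate_mul_shift hθ, age]
  ring

lemma lifetimeCDF_t (hθ : θ ∈ paramSpace) {j : ℕ} (hj : j ≤ D.L) :
    D.lifetimeCDF θ (D.t j) = 1 - Real.exp (-D.cumHazard θ j) := by
  rcases Nat.eq_zero_or_pos j with rfl | h
  · simp [lifetimeCDF, D.t_zero, D.cumHazard_zero]
  · rw [lifetimeCDF, if_pos (D.t_pos h hj), D.rate_mul_age hθ]

lemma prob_eq_cellProb (hθ : θ ∈ paramSpace) : D.prob θ = D.cellProb θ := by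
  ext ⟨j, hj⟩
  simp only [prob, cellProb, survival]
  by_cases h : j < D.L
  · rw [if_pos h, if_pos (by omega), if_pos (by omega), D.lifetimeCDF_t hθ (by omega),
      D.lifetimeCDF_t hθ (by omega)]
    ring
  · obtain rfl : j = D.L := by omega
    rw [if_neg h, if_pos le_rfl, if_neg (by omega), D.lifetimeCDF_t hθ le_rfl]
    ring

lemma cellProb_pos (hθ : θ ∈ paramSpace) (j : Fin (D.L + 1)) : 0 < D.cellProb θ j := by
  obtain ⟨j, hj⟩ := j
  simp only [cellProb, survival]
  by_cases h : j < D.L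
  · rw [if_pos (by omega), if_pos (by omega), sub_pos, Real.exp_lt_exp, neg_lt_neg_iff]
    exact D.cumHazard_lt_succ hθ h
  · rw [if_pos (by omega), if_neg (by omega), sub_zero]
    exact Real.exp_pos _

lemma sum_cellProb (θ : EuclideanSpace ℝ (Fin 2)) : ∑ j, D.cellProb θ j = 1 := by
  simp only [cellProb]
  rw [Fin.sum_univ_eq_sum_range (fun j => D.survival θ j - D.survival θ (j + 1)),
    Finset.sum_range_sub']
  simp [survival, D.cumHazard_zero]

lemma prob_pos (hθ : θ ∈ paramSpace) (j : Fin (D.L + 1)) : 0 < D.prob θ j := by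
  rw [D.prob_eq_cellProb hθ]
  exact D.cellProb_pos hθ j

lemma sum_prob (hθ : θ ∈ paramSpace) : ∑ j, D.prob θ j = 1 := by
  rw [D.prob_eq_cellProb hθ]
  exact D.sum_cellProb θ

lemma contDiff_cellProb : ContDiff ℝ 1 D.cellProb := by
  rw [contDiff_pi]
  have h : ∀ j, ContDiff ℝ 1 fun θ => D.survival θ j := by
    intro j
    unfold survival cumHazard rate
    split_ifs <;> fun_prop
  exact fun j => (h j).sub (h _)

/-- The linear functional with coefficients `c`. -/
noncomputable def coeffFunctional (c : Fin 2 → ℝ) : EuclideanSpace ℝ (Fin 2) →L[ℝ] ℝ :=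
  ∑ a, c a • EuclideanSpace.proj a

lemma coeffFunctional_apply (c : Fin 2 → ℝ) (v : EuclideanSpace ℝ (Fin 2)) :
    coeffFunctional c v = c ⬝ᵥ ⇑v := by
  simp [coeffFunctional, dotProduct]

lemma hasFDerivAt_rate (hθ : θ ∈ paramSpace) (i : ℕ) :
    HasFDerivAt (fun η => D.rate η i) (coeffFunctional ![D.rate θ i / θ 0, D.rate θ i * D.x i])
      θ := by
  have h0 : HasFDerivAt (fun η : EuclideanSpace ℝ (Fin 2) => η 0)
      (EuclideanSpace.proj 0 : EuclideanSpace ℝ (Fin 2) →L[ℝ] ℝ) θ :=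
    (EuclideanSpace.proj 0 : EuclideanSpace ℝ (Fin 2) →L[ℝ] ℝ).hasFDerivAt
  have h1 : HasFDerivAt (fun η : EuclideanSpace ℝ (Fin 2) => η 1)
      (EuclideanSpace.proj 1 : EuclideanSpace ℝ (Fin 2) →L[ℝ] ℝ) θ :=
    (EuclideanSpace.proj 1 : EuclideanSpace ℝ (Fin 2) →L[ℝ] ℝ).hasFDerivAt
  have hne : θ 0 ≠ 0 := (show 0 < θ 0 from hθ).ne'
  convert! h0.mul (h1.mul_const (D.x i)).exp using 1
  ext v
  simp [coeffFunctional, rate]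
  field_simp
  ring

lemma hasFDerivAt_cumHazard (hθ : θ ∈ paramSpace) (j : ℕ) :
    HasFDerivAt (fun η => D.cumHazard η j)
      (coeffFunctional (D.rate θ (D.level (D.t j)) • ![D.age θ (D.t j) / θ 0,
        D.age θ (D.t j) * D.x (D.level (D.t j)) + D.shiftStar θ (D.level (D.t j))])) θ := by
  have h := (HasFDerivAt.fun_sum (u := Finset.Icc 1 (D.level (D.t j) - 1)) fun m _ =>
    (D.hasFDerivAt_rate hθ m).const_mul (D.tau m - D.tau (m - 1))).add
      ((D.hasFDerivAt_rate hθ (D.level (D.t j))).mul_const (D.t j - D.tau (D.level (D.t j) - 1)))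
  refine h.congr_fderiv ?_
  have hr := (D.rate_pos hθ (D.level (D.t j))).ne'
  have hne : θ 0 ≠ 0 := (show 0 < θ 0 from hθ).ne'
  have e0 : D.rate θ (D.level (D.t j)) * (D.age θ (D.t j) / θ 0) = D.cumHazard θ j / θ 0 := by
    rw [← D.rate_mul_age hθ]; ring
  have e1 : D.rate θ (D.level (D.t j)) * (D.age θ (D.t j) * D.x (D.level (D.t j)) +
      D.shiftStar θ (D.level (D.t j))) =
      ∑ m ∈ Finset.Icc 1 (D.level (D.t j) - 1),
        (D.tau m - D.tau (m - 1)) * (D.rate θ m * D.x m) +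
      D.rate θ (D.level (D.t j)) * D.x (D.level (D.t j)) *
        (D.t j - D.tau (D.level (D.t j) - 1)) := by
    rw [mul_add, ← mul_assoc, D.rate_mul_age hθ, shiftStar, cumHazard, add_mul,
      Finset.sum_mul, mul_comm (1 / _), ← mul_assoc, mul_comm (D.rate θ _) (Finset.sum _ _),
      mul_assoc _ (D.rate θ _), mul_one_div_cancel hr, mul_one, add_right_comm,
      ← Finset.sum_add_distrib]
    congr 1
    · exact Finset.sum_congr rfl fun m _ => by ring
    · ring
  ext v
  simp only [coeffFunctional, Fin.sum_univ_two, Pi.smul_apply, Matrix.cons_val_zero,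
    Matrix.cons_val_one, smul_eq_mul, e0, e1]
  simp only [add_apply, sum_apply, smul_apply, PiLp.proj_apply, smul_eq_mul, cumHazard, add_mul,
    Finset.sum_mul, Finset.sum_div, add_div, mul_add, Finset.sum_add_distrib]
  have a1 : ∀ m, (D.tau m - D.tau (m - 1)) * (D.rate θ m / θ 0 * v 0) =
      (D.tau m - D.tau (m - 1)) * D.rate θ m / θ 0 * v 0 := fun m => by ring
  have a2 : ∀ m, (D.tau m - D.tau (m - 1)) * (D.rate θ m * D.x m * v 1) =
      (D.tau m - D.tau (m - 1)) * (D.rate θ m * D.x m) * v 1 := fun m => by ring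
  simp only [a1, a2]
  ring

/-- The vectors `z_j` are the gradients of the distribution function at the inspection times. -/
lemma hasFDerivAt_survival (hθ : θ ∈ paramSpace) (j : ℕ) :
    HasFDerivAt (fun η => D.survival η j) (-coeffFunctional (D.z θ j)) θ := by
  by_cases hj : j ≤ D.L
  · have hs : (fun η => D.survival η j) = fun η => Real.exp (-D.cumHazard η j) := by
      ext η; simp [survival, hj]
    rw [hs]
    rcases Nat.eq_zero_or_pos j with rfl | h
    · simp only [cumHazard_zero]
      convert! hasFDerivAt_const (𝕜 := ℝ) (1 : ℝ) θ using 1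
      · simp
      · ext v; simp [z, coeffFunctional]
    · refine (D.hasFDerivAt_cumHazard hθ j).neg.exp.congr_fderiv ?_
      rw [z, if_pos ⟨h, hj⟩, lifetimeDensity, if_pos (D.t_pos h hj), D.rate_mul_age hθ]
      ext v
      simp [coeffFunctional]
      ring
  · have hs : (fun η => D.survival η j) = fun _ => (0 : ℝ) := by
      ext η; simp [survival, hj]
    rw [hs, z, if_neg (by omega)]
    convert! hasFDerivAt_const (𝕜 := ℝ) (0 : ℝ) θ using 1
    ext v; simp [coeffFunctional]

/-- `W(θ)` is the Jacobian matrix of the cell probabilities. -/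
lemma fderiv_cellProb_apply (hθ : θ ∈ paramSpace) (v : EuclideanSpace ℝ (Fin 2))
    (j : Fin (D.L + 1)) : fderiv ℝ D.cellProb θ v j = (D.W θ *ᵥ ⇑v) j := by
  have h : HasFDerivAt D.cellProb (ContinuousLinearMap.pi fun j : Fin (D.L + 1) =>
      -coeffFunctional (D.z θ j) - -coeffFunctional (D.z θ (j + 1))) θ :=
    hasFDerivAt_pi.2 fun j => (D.hasFDerivAt_survival hθ j).sub (D.hasFDerivAt_survival hθ (j + 1))
  rw [h.fderiv]
  simp [W, Matrix.mulVec, dotProduct, coeffFunctional_apply]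
  ring

lemma sum_W (θ : EuclideanSpace ℝ (Fin 2)) (a : Fin 2) : ∑ j, D.W θ j a = 0 := by
  simp only [W, Matrix.of_apply, Pi.sub_apply]
  rw [Fin.sum_univ_eq_sum_range (fun j => D.z θ (j + 1) a - D.z θ j a),
    Finset.sum_range_sub (fun j => D.z θ j a)]
  simp [z]

/-- The index of the last but one cell. -/
def lastInspected : Fin (D.L + 1) := ⟨D.L - 1, by omega⟩

/-- The parameter recovered from the cell probabilities: the first cell determines the failure
rate at the lowest stress, the last two cells the one at the highest stress, and the
two rates determine `θ`. -/
noncomputable def recover (q : Fin (D.L + 1) → ℝ) : EuclideanSpace ℝ (Fin 2) :=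
  let a := Real.log (-Real.log (1 - q 0) / D.t 1)
  let b := Real.log (Real.log (q D.lastInspected / q (Fin.last D.L) + 1) /
    (D.t D.L - D.t (D.L - 1)))
  let s := (b - a) / (D.x D.k - D.x 1)
  WithLp.toLp 2 ![Real.exp (a - s * D.x 1), s]

/-- The open set of vectors on which `recover` is smooth; it contains all positive probability
vectors. -/
def recoverDomain : Set (Fin (D.L + 1) → ℝ) :=
  {q | 0 < q 0 ∧ q 0 < 1 ∧ 0 < q D.lastInspected ∧ 0 < q (Fin.last D.L)}

lemma isOpen_recoverDomain : IsOpen D.recoverDomain := by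
  refine IsOpen.and (isOpen_lt continuous_const (continuous_apply _)) ?_
  refine IsOpen.and (isOpen_lt (continuous_apply _) continuous_const) ?_
  exact (isOpen_lt continuous_const (continuous_apply _)).and
    (isOpen_lt continuous_const (continuous_apply _))

lemma recover_mem_paramSpace (q : Fin (D.L + 1) → ℝ) : D.recover q ∈ paramSpace := by
  simp only [recover, paramSpace, Set.mem_ofPred_eq]
  exact Real.exp_pos _

lemma t_last_sub_pos : 0 < D.t D.L - D.t (D.L - 1) := by
  have h := D.one_le_L
  have := D.t_lt_succ (j := D.L - 1) (by omega)
  rw [Nat.sub_add_cancel h] at this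
  linarith

lemma cellProb_mem_recoverDomain (hθ : θ ∈ paramSpace) : D.cellProb θ ∈ D.recoverDomain := by
  refine ⟨D.cellProb_pos hθ _, ?_, D.cellProb_pos hθ _, D.cellProb_pos hθ _⟩
  have h := D.one_le_L
  have hne : (0 : Fin (D.L + 1)) ≠ Fin.last D.L := by
    intro e
    have := congrArg Fin.val e
    simp at this
    omega
  have h2 := Finset.sum_le_sum_of_subset_of_nonneg (Finset.subset_univ {0, Fin.last D.L})
    fun j _ _ => (D.cellProb_pos hθ j).le
  rw [Finset.sum_pair hne, D.sum_cellProb] at h2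
  linarith [D.cellProb_pos hθ (Fin.last D.L)]

lemma differentiableAt_recover {q : Fin (D.L + 1) → ℝ} (hq : q ∈ D.recoverDomain) :
    DifferentiableAt ℝ D.recover q := by
  obtain ⟨h1, h2, h3, h4⟩ := hq
  have hlog : 0 < -Real.log (1 - q 0) := by
    have := Real.log_neg (x := 1 - q 0) (by linarith) (by linarith)
    linarith
  have hlog' : 0 < Real.log (q D.lastInspected / q (Fin.last D.L) + 1) :=
    Real.log_pos (by have := div_pos h3 h4; linarith)
  have ht := D.t_pos le_rfl D.one_le_L
  have ht' := D.t_last_sub_pos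
  have ha : DifferentiableAt ℝ
      (fun q : Fin (D.L + 1) → ℝ => Real.log (-Real.log (1 - q 0) / D.t 1)) q := by
    refine DifferentiableAt.log ?_ (div_pos hlog ht).ne'
    have : DifferentiableAt ℝ (fun q : Fin (D.L + 1) → ℝ => Real.log (1 - q 0)) q :=
      DifferentiableAt.log (by fun_prop) (by linarith)
    fun_prop
  have hb : DifferentiableAt ℝ (fun q : Fin (D.L + 1) → ℝ =>
      Real.log (Real.log (q D.lastInspected / q (Fin.last D.L) + 1) /
        (D.t D.L - D.t (D.L - 1)))) q := by
    refine DifferentiableAt.log ?_ (div_pos hlog' ht').ne'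
    have hne : q (Fin.last D.L) ≠ 0 := h4.ne'
    have : DifferentiableAt ℝ (fun q : Fin (D.L + 1) → ℝ =>
        Real.log (q D.lastInspected / q (Fin.last D.L) + 1)) q :=
      DifferentiableAt.log (by fun_prop (disch := assumption)) (by have := div_pos h3 h4; linarith)
    fun_prop
  unfold recover
  rw [differentiableAt_euclidean]
  intro i
  fin_cases i
  · simp only [Fin.zero_eta, Matrix.cons_val_zero]
    fun_prop
  · simp only [Fin.mk_one, Matrix.cons_val_one, Matrix.cons_val_fin_one]
    fun_prop

lemma x_one_lt_x_last : D.x 1 < D.x D.k := by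
  have hk := D.two_le_k
  exact D.x_strictMono (by simp; omega) (by simp; omega) (by omega)

lemma recover_cellProb (hθ : θ ∈ paramSpace) : D.recover (D.cellProb θ) = θ := by
  have hL := D.one_le_L
  have ht := D.t_pos le_rfl D.one_le_L
  have ht' := D.t_last_sub_pos
  have hpos : 0 < θ 0 := hθ
  have h0 : 1 - D.cellProb θ 0 = Real.exp (-(D.rate θ 1 * D.t 1)) := by
    simp only [cellProb, survival, Fin.val_zero, zero_add, hL, if_true, Nat.zero_le,
      cumHazard_zero, cumHazard_one]
    simp
  have h1 : D.cellProb θ D.lastInspected / D.cellProb θ (Fin.last D.L) + 1 =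
      Real.exp (D.rate θ D.k * (D.t D.L - D.t (D.L - 1))) := by
    have hl : D.cellProb θ (Fin.last D.L) = Real.exp (-D.cumHazard θ D.L) := by
      simp [cellProb, survival]
    have hl' : D.cellProb θ D.lastInspected =
        Real.exp (-D.cumHazard θ (D.L - 1)) - Real.exp (-D.cumHazard θ D.L) := by
      simp only [cellProb, survival, lastInspected, Nat.sub_add_cancel hL, le_refl, if_true,
        Nat.sub_le]
    rw [hl', hl, sub_div, div_self (Real.exp_pos _).ne', sub_add_cancel, ← Real.exp_sub,
      D.cumHazard_last]
    congr 1
    ring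
  have hlog : ∀ i, Real.log (D.rate θ i) = Real.log (θ 0) + θ 1 * D.x i := fun i => by
    rw [rate, Real.log_mul hpos.ne' (Real.exp_pos _).ne', Real.log_exp]
  have hx := sub_pos.2 D.x_one_lt_x_last
  have hs : (Real.log (θ 0) + θ 1 * D.x D.k - (Real.log (θ 0) + θ 1 * D.x 1)) /
      (D.x D.k - D.x 1) = θ 1 := by
    rw [div_eq_iff hx.ne']
    ring
  simp only [recover]
  rw [h0, h1, Real.log_exp, Real.log_exp, neg_neg, mul_div_cancel_right₀ _ ht.ne',
    mul_div_cancel_right₀ _ ht'.ne', hlog, hlog, hs, add_sub_cancel_right, Real.exp_log hpos]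
  ext i
  fin_cases i <;> simp

lemma isOpen_paramSpace : IsOpen paramSpace :=
  isOpen_lt continuous_const (EuclideanSpace.proj (𝕜 := ℝ) (0 : Fin 2)).continuous

/-- The Jacobian of the cell probabilities is injective, because `recover` is a differentiable
left inverse. -/
lemma fderiv_cellProb_injective (hθ : θ ∈ paramSpace) :
    Function.Injective (fderiv ℝ D.cellProb θ) := by
  have h1 : HasFDerivAt D.cellProb (fderiv ℝ D.cellProb θ) θ :=
    ((D.contDiff_cellProb.differentiable (by norm_num)) θ).hasFDerivAt
  have h2 := (D.differentiableAt_recover (D.cellProb_mem_recoverDomain hθ)).hasFDerivAt.comp θ h1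
  have h3 : HasFDerivAt (D.recover ∘ D.cellProb) (ContinuousLinearMap.id ℝ _) θ := by
    refine (hasFDerivAt_id θ).congr_of_eventuallyEq ?_
    filter_upwards [isOpen_paramSpace.mem_nhds hθ] with η hη
    exact D.recover_cellProb hη
  have h4 := h2.unique h3
  intro u v huv
  have := congrArg (fun f => f u) h4
  have h' := congrArg (fun f => f v) h4
  simp only [ContinuousLinearMap.comp_apply, ContinuousLinearMap.id_apply] at this h'
  rw [← this, ← h', huv]

end Design

end StepStress

/-! ### The density power divergence and estimating equations -/

namespace StepStress

open Asymptotics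

/-- A continuous function of two numbers that vanishes only on the diagonal and whose sum over the
cells bounds the divergence from below: for `β > 0` it is the summand of the divergence itself, for
`β = 0` the summand of the squared Hellinger distance. -/
noncomputable def dpdBound (β a b : ℝ) : ℝ :=
  if β = 0 then (√a - √b) ^ 2
  else b ^ (1 + β) - (1 + 1 / β) * a * b ^ β + 1 / β * a ^ (β + 1)

lemma continuous_dpdBound {β : ℝ} (hβ : 0 ≤ β) :
    Continuous fun x : ℝ × ℝ => dpdBound β x.1 x.2 := by
  unfold dpdBound
  split_ifs
  · fun_prop
  · have h1 : Continuous fun x : ℝ × ℝ => x.2 ^ (1 + β) :=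
      continuous_snd.rpow_const fun _ => Or.inr (by linarith)
    have h2 : Continuous fun x : ℝ × ℝ => x.2 ^ β :=
      continuous_snd.rpow_const fun _ => Or.inr hβ
    have h3 : Continuous fun x : ℝ × ℝ => x.1 ^ (β + 1) :=
      continuous_fst.rpow_const fun _ => Or.inr (by linarith)
    fun_prop

lemma dpdBound_self {β a : ℝ} (hβ : 0 ≤ β) (ha : 0 ≤ a) : dpdBound β a a = 0 := by
  unfold dpdBound
  split_ifs with h
  · simp
  · have e : a ^ (1 + β) = a * a ^ β := by
      rw [Real.rpow_add_of_nonneg ha zero_le_one hβ, Real.rpow_one]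
    rw [add_comm β 1, e]
    ring

/-- For `β > 0` this is Bernoulli's inequality for `a / b`. -/
lemma dpdBound_pos {β a b : ℝ} (hβ : 0 ≤ β) (ha : 0 ≤ a) (hb : 0 ≤ b) (hab : a ≠ b) :
    0 < dpdBound β a b := by
  unfold dpdBound
  split_ifs with h
  · have : √a - √b ≠ 0 := sub_ne_zero.2 fun e => hab ((Real.sqrt_inj ha hb).1 e)
    positivity
  · have hβ' : 0 < β := lt_of_le_of_ne hβ (Ne.symm h)
    rcases hb.eq_or_lt with rfl | hb'
    · have ha' : 0 < a := lt_of_le_of_ne ha (Ne.symm hab)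
      rw [Real.zero_rpow (by linarith), Real.zero_rpow h]
      have := Real.rpow_pos_of_pos ha' (β + 1)
      simp only [mul_zero, sub_zero, zero_add]
      positivity
    · have hs : a / b - 1 ≠ 0 := by
        rw [sub_ne_zero]
        intro e
        exact hab ((div_eq_one_iff_eq hb'.ne').1 e)
      have hB := one_add_mul_self_lt_rpow_one_add (s := a / b - 1) (p := 1 + β)
        (by have := div_nonneg ha hb; linarith) hs (by linarith)
      rw [add_sub_cancel, Real.div_rpow ha hb, lt_div_iff₀ (Real.rpow_pos_of_pos hb' _)] at hB
      have e : b ^ (1 + β) = b * b ^ β := by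
        rw [Real.rpow_add hb', Real.rpow_one]
      rw [add_comm β 1]
      rw [e] at hB ⊢
      have e2 : (1 + (1 + β) * (a / b - 1)) * (b * b ^ β) =
          (1 + β) * a * b ^ β - β * (b * b ^ β) := by
        field_simp
        ring
      rw [e2] at hB
      have e3 : b * b ^ β - (1 + 1 / β) * a * b ^ β + 1 / β * a ^ (1 + β) =
          1 / β * (a ^ (1 + β) - ((1 + β) * a * b ^ β - β * (b * b ^ β))) := by
        field_simp
        ring
      rw [e3]
      exact mul_pos (by positivity) (sub_pos.2 hB)

lemma dpdBound_nonneg {β a b : ℝ} (hβ : 0 ≤ β) (ha : 0 ≤ a) (hb : 0 ≤ b) :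
    0 ≤ dpdBound β a b := by
  rcases eq_or_ne a b with rfl | hab
  · exact (dpdBound_self hβ ha).ge
  · exact (dpdBound_pos hβ ha hb hab).le

variable {m : ℕ}

/-- For `β = 0` this bounds the Kullback-Leibler divergence by the squared Hellinger distance,
through `log x ≤ x - 1` at `x = √(q / p)`. -/
lemma sum_dpdBound_le_dpd {β : ℝ} {p q : Fin m → ℝ} (hp : p ∈ stdSimplex ℝ (Fin m))
    (hq : q ∈ stdSimplex ℝ (Fin m)) (hq' : ∀ j, 0 < q j) :
    ∑ j, dpdBound β (p j) (q j) ≤ dpd β p q := by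
  unfold dpdBound dpd
  split_ifs with h
  · have key : ∀ j, (√(p j) - √(q j)) ^ 2 ≤ p j * Real.log (p j / q j) - p j + q j := by
      intro j
      have hsq := Real.sq_sqrt (hp.1 j)
      have hsq' := Real.sq_sqrt (hq' j).le
      rcases (hp.1 j).eq_or_lt with h0 | hpos
      · rw [← h0] at *
        simp [hsq']
      · have hsp := Real.sqrt_pos.2 hpos
        have hsq0 := Real.sqrt_pos.2 (hq' j)
        have hl := Real.log_le_sub_one_of_pos (div_pos hsq0 hsp)
        have e : Real.log (p j / q j) = -2 * Real.log (√(q j) / √(p j)) := by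
          rw [Real.log_div hpos.ne' (hq' j).ne', Real.log_div hsq0.ne' hsp.ne',
            Real.log_sqrt hpos.le, Real.log_sqrt (hq' j).le]
          ring
        have hl2 := mul_le_mul_of_nonneg_left hl hpos.le
        have e2 : p j * (√(q j) / √(p j) - 1) = √(p j) * √(q j) - p j := by
          nth_rewrite 1 [← hsq]
          field_simp
          linear_combination -hsq
        rw [e2] at hl2
        rw [e]
        nlinarith
    calc ∑ j, (√(p j) - √(q j)) ^ 2
        ≤ ∑ j, (p j * Real.log (p j / q j) - p j + q j) := Finset.sum_le_sum fun j _ => key j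
      _ = ∑ j, p j * Real.log (p j / q j) := by
        rw [Finset.sum_add_distrib, Finset.sum_sub_distrib, hp.2, hq.2]
        ring
  · exact le_rfl

lemma dpd_self {β : ℝ} (hβ : 0 ≤ β) {p : Fin m → ℝ} (hp : ∀ j, 0 < p j) : dpd β p p = 0 := by
  unfold dpd
  split_ifs with h
  · exact Finset.sum_eq_zero fun j _ => by simp [div_self (hp j).ne']
  · refine Finset.sum_eq_zero fun j _ => ?_
    have := dpdBound_self hβ (hp j).le
    rwa [dpdBound, if_neg h] at this

lemma continuousAt_dpd_self (β : ℝ) {q : Fin m → ℝ} (hq : ∀ j, 0 < q j) :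
    ContinuousAt (fun p => dpd β p q) q := by
  unfold dpd
  split_ifs with h
  · refine tendsto_finsetSum _ fun j _ => ?_
    have h1 : ContinuousAt (fun p : Fin m → ℝ => p j) q := (continuous_apply j).continuousAt
    exact h1.mul ((h1.div_const _).log (div_pos (hq j) (hq j)).ne')
  · refine tendsto_finsetSum _ fun j _ => ?_
    have h1 : ContinuousAt (fun p : Fin m → ℝ => p j) q := (continuous_apply j).continuousAt
    exact (continuousAt_const.sub ((continuousAt_const.mul h1).mul continuousAt_const)).add
      (continuousAt_const.mul (h1.rpow_const (Or.inl (hq j).ne')))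

/-- By compactness of the unit square the divergence separates probability vectors uniformly: a
vector that fits `p` at least as well as `q₀` is close to `q₀` when `p` is. -/
lemma eventually_dist_le_of_dpd_le {β : ℝ} (hβ : 0 ≤ β) {q₀ : Fin m → ℝ} (hq₀ : ∀ j, 0 < q₀ j)
    {r : ℝ} (hr : 0 < r) :
    ∀ᶠ p in 𝓝 q₀, p ∈ stdSimplex ℝ (Fin m) → ∀ q ∈ stdSimplex ℝ (Fin m), (∀ j, 0 < q j) →
      dpd β p q ≤ dpd β p q₀ → dist q q₀ ≤ r := by
  obtain ⟨η, hη, hgap⟩ : ∃ η > 0, ∀ x ∈ Set.Icc (0 : ℝ) 1 ×ˢ Set.Icc (0 : ℝ) 1,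
      r / 2 ≤ |x.1 - x.2| → η ≤ dpdBound β x.1 x.2 := by
    have hc : IsCompact ((Set.Icc (0 : ℝ) 1 ×ˢ Set.Icc (0 : ℝ) 1) ∩
        {x : ℝ × ℝ | r / 2 ≤ |x.1 - x.2|}) :=
      (isCompact_Icc.prod isCompact_Icc).inter_right
        (isClosed_le continuous_const (by fun_prop))
    rcases Set.eq_empty_or_nonempty ((Set.Icc (0 : ℝ) 1 ×ˢ Set.Icc (0 : ℝ) 1) ∩
        {x : ℝ × ℝ | r / 2 ≤ |x.1 - x.2|}) with he | hne
    · exact ⟨1, one_pos, fun x hx hx' => absurd (Set.mem_inter hx hx') (by rw [he]; simp)⟩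
    · obtain ⟨x, hx, hmin⟩ := hc.exists_isMinOn hne (continuous_dpdBound hβ).continuousOn
      refine ⟨_, dpdBound_pos hβ hx.1.1.1 hx.1.2.1 ?_, fun y hy hy' => hmin ⟨hy, hy'⟩⟩
      intro e
      have := hx.2
      simp only [Set.mem_ofPred_eq, e, sub_self, abs_zero] at this
      linarith
  have h0 : ∀ᶠ p in 𝓝 q₀, dpd β p q₀ < η :=
    (continuousAt_dpd_self β hq₀).eventually_lt_const (by
      show dpd β q₀ q₀ < η
      rwa [dpd_self hβ hq₀])
  filter_upwards [h0, Metric.closedBall_mem_nhds q₀ (half_pos hr)] with p hp hpd hps q hqs hq hle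
  have hd : dist q p ≤ r / 2 := by
    refine (dist_pi_le_iff (by positivity)).2 fun j => ?_
    by_contra! hlt
    have h1 : ∀ s ∈ stdSimplex ℝ (Fin m), s j ∈ Set.Icc (0 : ℝ) 1 := fun s hs =>
      ⟨hs.1 j, hs.2 ▸ Finset.single_le_sum (fun i _ => hs.1 i) (Finset.mem_univ j)⟩
    have h2 : η ≤ dpdBound β (p j) (q j) := by
      refine hgap (p j, q j) ⟨h1 p hps, h1 q hqs⟩ ?_
      rw [← Real.dist_eq, dist_comm]
      exact hlt.le
    have h3 : dpdBound β (p j) (q j) ≤ ∑ i, dpdBound β (p i) (q i) :=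
      Finset.single_le_sum (fun i _ => dpdBound_nonneg hβ (hps.1 i) (hqs.1 i)) (Finset.mem_univ j)
    linarith [sum_dpdBound_le_dpd (β := β) hps hqs hq]
  calc dist q q₀ ≤ dist q p + dist p q₀ := dist_triangle _ _ _
    _ ≤ r := by have := Metric.mem_closedBall.1 hpd; linarith

lemma hasDerivAt_mul_log_div (a : ℝ) {b : ℝ} (hb : 0 < b) :
    HasDerivAt (fun b => a * Real.log (a / b)) (b ^ (0 - 1 : ℝ) * (b - a) - 1) b := by
  rw [zero_sub, Real.rpow_neg_one, mul_sub, inv_mul_cancel₀ hb.ne']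
  rcases eq_or_ne a 0 with rfl | ha
  · simpa using hasDerivAt_const b (0 : ℝ)
  · have h1 : HasDerivAt (fun b => a * (Real.log a - Real.log b)) (a * (0 - b⁻¹)) b :=
      ((hasDerivAt_const b (Real.log a)).sub (Real.hasDerivAt_log hb.ne')).const_mul a
    refine (h1.congr_of_eventuallyEq ?_).congr_deriv (by ring)
    filter_upwards [eventually_ne_nhds hb.ne'] with c hc
    rw [Real.log_div ha hc]

/-- Up to the factor `1 + β`, and up to a term that vanishes when the total mass of `q` is
constant, the gradient of the divergence in its second argument is `q ^ (β - 1) * (q - p)`. -/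
lemma hasFDerivAt_dpd {E : Type*} [NormedAddCommGroup E] [NormedSpace ℝ E] {β : ℝ} (hβ : 0 ≤ β)
    (p : Fin m → ℝ) {q : E → Fin m → ℝ} {q' : E →L[ℝ] (Fin m → ℝ)} {θ : E}
    (hq : HasFDerivAt q q' θ) (hpos : ∀ j, 0 < q θ j) (hsum : ∀ v, ∑ j, q' v j = 0) :
    HasFDerivAt (fun η => dpd β p (q η))
      (∑ j, ((1 + β) * (q θ j ^ (β - 1) * (q θ j - p j))) •
        (ContinuousLinearMap.proj (R := ℝ) (φ := fun _ : Fin m => ℝ) j ∘L q')) θ := by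
  have hqj : ∀ j, HasFDerivAt (fun η => q η j)
      (ContinuousLinearMap.proj (R := ℝ) (φ := fun _ : Fin m => ℝ) j ∘L q') θ :=
    fun j => hasFDerivAt_pi'.1 hq j
  unfold dpd
  split_ifs with h
  · subst h
    refine (HasFDerivAt.fun_sum fun j _ => (hasDerivAt_mul_log_div (p j) (hpos j)).comp_hasFDerivAt
      θ (hqj j)).congr_fderiv ?_
    ext v
    simp [sub_mul, Finset.sum_sub_distrib, hsum]
  · have hβ' : 0 < β := lt_of_le_of_ne hβ (Ne.symm h)
    have hd : ∀ j, HasDerivAt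
        (fun b : ℝ => b ^ (1 + β) - (1 + 1 / β) * p j * b ^ β + 1 / β * p j ^ (β + 1))
        ((1 + β) * (q θ j ^ (β - 1) * (q θ j - p j))) (q θ j) := by
      intro j
      have h1 := Real.hasDerivAt_rpow_const (x := q θ j) (p := 1 + β) (Or.inl (hpos j).ne')
      have h2 := (Real.hasDerivAt_rpow_const (x := q θ j) (p := β)
        (Or.inl (hpos j).ne')).const_mul ((1 + 1 / β) * p j)
      refine ((h1.sub h2).add_const _).congr_deriv ?_
      have e : q θ j ^ (1 + β - 1) = q θ j ^ (β - 1) * q θ j := by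
        rw [← Real.rpow_add_one (hpos j).ne']
        congr 1
        ring
      rw [e]
      field_simp
      ring
    exact HasFDerivAt.fun_sum fun j _ =>
      HasDerivAt.comp_hasFDerivAt (h₂ := fun b : ℝ =>
        b ^ (1 + β) - (1 + 1 / β) * p j * b ^ β + 1 / β * p j ^ (β + 1)) θ (hd j) (hqj j)

/-- A root `θ` of an estimating equation `B(θ) (q(θ) - p) = 0` that converges to `θ₀` is, to first
order in `p - q(θ₀)`, the solution of the equation linearized at `θ₀`. -/
lemma isLittleO_of_estimating_equation {α E F G : Type*} [NormedAddCommGroup E] [NormedSpace ℝ E]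
    [NormedAddCommGroup F] [NormedSpace ℝ F] [NormedAddCommGroup G] [NormedSpace ℝ G]
    {l : Filter α} {θ : α → E} {θ₀ : E} {p : α → F} {q : E → F} {q' : E →L[ℝ] F}
    {B : E → F →L[ℝ] G} {C : ℝ} (hθ : Tendsto θ l (𝓝 θ₀)) (hq : HasFDerivAt q q' θ₀)
    (hB : ContinuousAt B θ₀) (hinj : ∀ u, ‖u‖ ≤ C * ‖B θ₀ (q' u)‖)
    (heq : ∀ᶠ x in l, B (θ x) (q (θ x) - p x) = 0) :
    (fun x => B θ₀ (q' (θ x - θ₀)) - B θ₀ (p x - q θ₀)) =o[l] fun x => p x - q θ₀ := by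
  set u : α → E := fun x => θ x - θ₀
  set y : α → F := fun x => p x - q θ₀
  have h1 : (fun x => q (θ x) - q θ₀ - q' (u x)) =o[l] u :=
    hq.isLittleO.comp_tendsto hθ
  have h2 : (fun x => q (θ x) - q θ₀) =O[l] u := hq.isBigO_sub.comp_tendsto hθ
  have h3 : (fun x => B (θ x) - B θ₀) =o[l] fun _ => (1 : ℝ) := by
    rw [isLittleO_one_iff]
    have := (hB.tendsto.comp hθ).sub_const (B θ₀)
    simpa using this
  have happ : ∀ {w : α → F}, (fun x => (B (θ x) - B θ₀) (w x)) =o[l] w := by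
    intro w
    have h4 : (fun x => ‖B (θ x) - B θ₀‖ * ‖w x‖) =o[l] fun x => (1 : ℝ) * ‖w x‖ :=
      h3.norm_left.mul_isBigO (isBigO_refl _ _)
    simp only [one_mul] at h4
    refine IsBigO.trans_isLittleO ?_ h4.norm_right.of_norm_right.of_norm_right
    exact IsBigO.of_bound 1 (Eventually.of_forall fun x => by
      rw [one_mul, Real.norm_of_nonneg (by positivity)]
      exact ContinuousLinearMap.le_opNorm _ _)
  have e1 : (fun x => -B θ₀ (q (θ x) - q θ₀ - q' (u x)) -
      (B (θ x) - B θ₀) (q (θ x) - q θ₀)) =o[l] u :=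
    (((B θ₀).isBigO_comp _ _).trans_isLittleO h1).neg_left.sub (happ.trans_isBigO h2)
  have hdecomp : (fun x => B θ₀ (q' (u x)) - B θ₀ (y x)) =ᶠ[l] fun x =>
      (-B θ₀ (q (θ x) - q θ₀ - q' (u x)) - (B (θ x) - B θ₀) (q (θ x) - q θ₀)) +
        (B (θ x) - B θ₀) (y x) := by
    filter_upwards [heq] with x hx
    have : B (θ x) (q (θ x)) = B (θ x) (p x) := by rwa [map_sub, sub_eq_zero] at hx
    simp only [y, map_sub, sub_apply, this]
    abel
  have hu : u =O[l] fun x => B θ₀ (q' (u x)) :=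
    IsBigO.of_bound C (Eventually.of_forall fun x => hinj (u x))
  -- the terms of order `o(u)` are absorbed on the left-hand side, so `u` is controlled by `y`
  have huy : u =O[l] y := by
    have h5 := (e1.trans_isBigO hu).right_isBigO_sub
    refine hu.trans (h5.trans ?_)
    have h6 : (fun x => B θ₀ (q' (u x)) - (-B θ₀ (q (θ x) - q θ₀ - q' (u x)) -
        (B (θ x) - B θ₀) (q (θ x) - q θ₀))) =ᶠ[l]
        fun x => B θ₀ (y x) + (B (θ x) - B θ₀) (y x) := by
      filter_upwards [hdecomp] with x hx
      rw [sub_eq_iff_eq_add] at hx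
      rw [hx]
      abel
    exact h6.trans_isBigO (((B θ₀).isBigO_comp _ _).add happ.isBigO)
  exact hdecomp.trans_isLittleO ((e1.trans_isBigO huy).add happ)

end StepStress

/-! ### Differentiability of the minimum divergence functional -/

namespace StepStress

open Asymptotics

namespace Design

variable (D : Design) {θ θ₀ : EuclideanSpace ℝ (Fin 2)} {β : ℝ}

lemma prob_mem_stdSimplex (hθ : θ ∈ paramSpace) : D.prob θ ∈ stdSimplex ℝ (Fin (D.L + 1)) :=
  ⟨fun j => (D.prob_pos hθ j).le, D.sum_prob hθ⟩

lemma hasFDerivAt_prob (hθ : θ ∈ paramSpace) :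
    HasFDerivAt D.prob (fderiv ℝ D.cellProb θ) θ := by
  refine ((D.contDiff_cellProb.differentiable (by norm_num)) θ).hasFDerivAt.congr_of_eventuallyEq ?_
  filter_upwards [isOpen_paramSpace.mem_nhds hθ] with η hη
  exact D.prob_eq_cellProb hη

lemma recover_prob (hθ : θ ∈ paramSpace) : D.recover (D.prob θ) = θ := by
  rw [D.prob_eq_cellProb hθ, D.recover_cellProb hθ]

lemma prob_mem_recoverDomain (hθ : θ ∈ paramSpace) : D.prob θ ∈ D.recoverDomain := by
  rw [D.prob_eq_cellProb hθ]
  exact D.cellProb_mem_recoverDomain hθ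

lemma sum_fderiv_cellProb (hθ : θ ∈ paramSpace) (v : EuclideanSpace ℝ (Fin 2)) :
    ∑ j, fderiv ℝ D.cellProb θ v j = 0 := by
  simp only [D.fderiv_cellProb_apply hθ, Matrix.mulVec, dotProduct, Fin.sum_univ_two,
    Finset.sum_add_distrib, ← Finset.sum_mul, D.sum_W, zero_mul, add_zero]

/-- The linear map that sends `y` to the functional `v ↦ ∑ j, π_j ^ (β - 1) y_j (W v)_j`. -/
noncomputable def scoreMap (β : ℝ) (θ : EuclideanSpace ℝ (Fin 2)) :
    (Fin (D.L + 1) → ℝ) →L[ℝ] EuclideanSpace ℝ (Fin 2) →L[ℝ] ℝ :=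
  ∑ j, (D.cellProb θ j ^ (β - 1)) •
    ContinuousLinearMap.smulRightL ℝ (Fin (D.L + 1) → ℝ) (EuclideanSpace ℝ (Fin 2) →L[ℝ] ℝ)
      (ContinuousLinearMap.proj (R := ℝ) (φ := fun _ : Fin (D.L + 1) => ℝ) j)
      (ContinuousLinearMap.proj (R := ℝ) (φ := fun _ : Fin (D.L + 1) => ℝ) j ∘L
        fderiv ℝ D.cellProb θ)

lemma scoreMap_apply (β : ℝ) (θ v : EuclideanSpace ℝ (Fin 2)) (y : Fin (D.L + 1) → ℝ) :
    D.scoreMap β θ y v = ∑ j, D.cellProb θ j ^ (β - 1) * (y j * fderiv ℝ D.cellProb θ v j) := by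
  simp [scoreMap]

-- continuity of addition on the nested space of linear maps needs a deeper instance search
set_option maxSynthPendingDepth 4 in
lemma continuousAt_scoreMap (β : ℝ) (hθ : θ ∈ paramSpace) : ContinuousAt (D.scoreMap β) θ := by
  refine tendsto_finsetSum _ fun j _ => ?_
  have h1 : ContinuousAt (fun η => D.cellProb η j ^ (β - 1)) θ :=
    ((continuous_apply j).comp D.contDiff_cellProb.continuous).continuousAt.rpow_const
      (Or.inl (D.cellProb_pos hθ j).ne')
  have h2 : Continuous (fderiv ℝ D.cellProb) := D.contDiff_cellProb.continuous_fderiv (by norm_num)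
  refine h1.smul (Continuous.continuousAt ?_)
  fun_prop

lemma scoreMap_apply_eq (β : ℝ) (hθ : θ ∈ paramSpace) (v : EuclideanSpace ℝ (Fin 2))
    (y : Fin (D.L + 1) → ℝ) : D.scoreMap β θ y v =
      ⇑v ⬝ᵥ (((D.W θ)ᵀ * Matrix.diagonal (fun j => D.prob θ j ^ (β - 1))) *ᵥ y) := by
  rw [← Matrix.mulVec_mulVec, Matrix.dotProduct_mulVec, Matrix.vecMul_transpose,
    scoreMap_apply, D.prob_eq_cellProb hθ]
  simp only [D.fderiv_cellProb_apply hθ, dotProduct, Matrix.mulVec_diagonal]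
  exact Finset.sum_congr rfl fun j _ => by ring

/-- The estimating equation: the parameter space is open, so a minimizer is a
critical point. -/
lemma IsMDPDE.scoreMap_eq_zero (hβ : 0 ≤ β) {p : Fin (D.L + 1) → ℝ} (h : D.IsMDPDE β p θ) :
    D.scoreMap β θ (D.prob θ - p) = 0 := by
  have hmin := h.2.isLocalMin (isOpen_paramSpace.mem_nhds h.1)
  have h0 := hmin.hasFDerivAt_eq_zero (hasFDerivAt_dpd hβ p (D.hasFDerivAt_prob h.1)
    (D.prob_pos h.1) (D.sum_fderiv_cellProb h.1))
  ext v
  have h1 := congrArg (fun f => f v) h0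
  simp only [sum_apply, smul_apply, ContinuousLinearMap.comp_apply, ContinuousLinearMap.proj_apply,
    smul_eq_mul, zero_apply, mul_assoc, ← Finset.mul_sum] at h1
  rw [scoreMap_apply, ← D.prob_eq_cellProb h.1]
  simpa [(show (1 + β) ≠ 0 by positivity)] using h1

lemma eventually_prob_near (hβ : 0 ≤ β) (hθ₀ : θ₀ ∈ paramSpace) {r : ℝ} (hr : 0 < r) :
    ∀ᶠ p in 𝓝 (D.prob θ₀), p ∈ stdSimplex ℝ (Fin (D.L + 1)) → ∀ θ ∈ paramSpace,
      dpd β p (D.prob θ) ≤ dpd β p (D.prob θ₀) → dist (D.prob θ) (D.prob θ₀) ≤ r := by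
  filter_upwards [eventually_dist_le_of_dpd_le hβ (D.prob_pos hθ₀) hr] with p hp hps θ hθ hle
  exact hp hps _ (D.prob_mem_stdSimplex hθ) (D.prob_pos hθ) hle

/-- When `p` is close to `π(θ₀)`, only parameters in the image under `recover` of a closed ball
compete with `θ₀`, and that image is a compact subset of the parameter space. -/
lemma eventually_exists_isMDPDE (hβ : 0 ≤ β) (hθ₀ : θ₀ ∈ paramSpace) :
    ∀ᶠ p in 𝓝 (D.prob θ₀), p ∈ stdSimplex ℝ (Fin (D.L + 1)) → ∃ θ, D.IsMDPDE β p θ := by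
  obtain ⟨r, hr, hball⟩ := Metric.nhds_basis_closedBall.mem_iff.1
    (D.isOpen_recoverDomain.mem_nhds (D.prob_mem_recoverDomain hθ₀))
  set K := D.recover '' Metric.closedBall (D.prob θ₀) r
  have hK : IsCompact K := (isCompact_closedBall _ _).image_of_continuousOn fun q hq =>
    (D.differentiableAt_recover (hball hq)).continuousAt.continuousWithinAt
  have hKΘ : K ⊆ paramSpace := by
    rintro _ ⟨q, -, rfl⟩
    exact D.recover_mem_paramSpace q
  have hK₀ : θ₀ ∈ K := ⟨D.prob θ₀, Metric.mem_closedBall_self hr.le, D.recover_prob hθ₀⟩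
  filter_upwards [D.eventually_prob_near hβ hθ₀ hr] with p hp hps
  have hcont : ContinuousOn (fun η => dpd β p (D.prob η)) K := fun η hη =>
    (hasFDerivAt_dpd hβ p (D.hasFDerivAt_prob (hKΘ hη)) (D.prob_pos (hKΘ hη))
      (D.sum_fderiv_cellProb (hKΘ hη))).continuousAt.continuousWithinAt
  obtain ⟨θ, hθ, hmin⟩ := hK.exists_isMinOn ⟨θ₀, hK₀⟩ hcont
  refine ⟨θ, hKΘ hθ, fun η hη => ?_⟩
  by_cases hle : dpd β p (D.prob η) ≤ dpd β p (D.prob θ₀)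
  · exact hmin (show η ∈ K from ⟨D.prob η, hp hps η hη hle, D.recover_prob hη⟩)
  · exact (hmin hK₀).trans (le_of_not_ge hle)

/-- The filter on pairs `(p, θ)` that describes `p → π(θ₀)` along probability vectors `p`, where
`θ` is any minimum divergence estimate for `p`. -/
noncomputable def mdpdeFilter (β : ℝ) (θ₀ : EuclideanSpace ℝ (Fin 2)) :
    Filter ((Fin (D.L + 1) → ℝ) × EuclideanSpace ℝ (Fin 2)) :=
  comap Prod.fst (𝓝 (D.prob θ₀)) ⊓
    𝓟 {x | x.1 ∈ stdSimplex ℝ (Fin (D.L + 1)) ∧ D.IsMDPDE β x.1 x.2}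

lemma eventually_mdpdeFilter :
    ∀ᶠ x in D.mdpdeFilter β θ₀, x.1 ∈ stdSimplex ℝ (Fin (D.L + 1)) ∧ D.IsMDPDE β x.1 x.2 :=
  mem_inf_of_right (mem_principal_self _)

lemma tendsto_fst_mdpdeFilter : Tendsto Prod.fst (D.mdpdeFilter β θ₀) (𝓝 (D.prob θ₀)) :=
  tendsto_comap.mono_left inf_le_left

/-- Consistency of the estimates, by continuity of `recover`. -/
lemma tendsto_snd_mdpdeFilter (hβ : 0 ≤ β) (hθ₀ : θ₀ ∈ paramSpace) :
    Tendsto Prod.snd (D.mdpdeFilter β θ₀) (𝓝 θ₀) := by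
  have hprob : Tendsto (fun x => D.prob x.2) (D.mdpdeFilter β θ₀) (𝓝 (D.prob θ₀)) := by
    refine Metric.nhds_basis_closedBall.tendsto_right_iff.2 fun r hr => ?_
    filter_upwards [D.tendsto_fst_mdpdeFilter.eventually (D.eventually_prob_near hβ hθ₀ hr),
      D.eventually_mdpdeFilter] with x hx hx'
    exact hx hx'.1 _ hx'.2.1 (hx'.2.2 hθ₀)
  have hrec := (D.differentiableAt_recover (D.prob_mem_recoverDomain hθ₀)).continuousAt.tendsto
  rw [D.recover_prob hθ₀] at hrec
  refine (hrec.comp hprob).congr' ?_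
  filter_upwards [D.eventually_mdpdeFilter] with x hx
  exact D.recover_prob hx.2.1

lemma W_mulVec_injective (hθ : θ ∈ paramSpace) : Function.Injective (D.W θ).mulVec := by
  intro u v huv
  have := @D.fderiv_cellProb_injective θ hθ (WithLp.toLp 2 u) (WithLp.toLp 2 v) (by
    ext j
    rw [D.fderiv_cellProb_apply hθ, D.fderiv_cellProb_apply hθ]
    exact congrFun huv j)
  simpa using this

lemma posDef_J (β : ℝ) (hθ : θ ∈ paramSpace) : (D.J θ β).PosDef := by
  have := (Matrix.PosDef.diagonal (d := fun j => D.prob θ j ^ (β - 1))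
    fun j => Real.rpow_pos_of_pos (D.prob_pos hθ j) _).conjTranspose_mul_mul_same
      (D.W_mulVec_injective hθ)
  rwa [Matrix.conjTranspose_eq_transpose_of_trivial] at this

/-- The matrix of the first-order dependence of the estimate on the empirical probabilities. -/
noncomputable def influence (β : ℝ) (θ : EuclideanSpace ℝ (Fin 2)) :
    Matrix (Fin 2) (Fin (D.L + 1)) ℝ :=
  (D.J θ β)⁻¹ * ((D.W θ)ᵀ * Matrix.diagonal (fun j => D.prob θ j ^ (β - 1)))

/-- The minimum divergence functional is differentiable at `π(θ₀)`, with derivative `influence`. -/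
theorem isLittleO_mdpde (hβ : 0 ≤ β) (hθ₀ : θ₀ ∈ paramSpace) :
    (fun x : (Fin (D.L + 1) → ℝ) × EuclideanSpace ℝ (Fin 2) =>
      x.2 - θ₀ - WithLp.toLp 2 (D.influence β θ₀ *ᵥ (x.1 - D.prob θ₀)))
      =o[D.mdpdeFilter β θ₀] fun x => x.1 - D.prob θ₀ := by
  set S := (D.W θ₀)ᵀ * Matrix.diagonal (fun j => D.prob θ₀ j ^ (β - 1))
  have hJS : ∀ u v : EuclideanSpace ℝ (Fin 2),
      D.scoreMap β θ₀ (fderiv ℝ D.cellProb θ₀ u) v = ⇑v ⬝ᵥ (D.J θ₀ β *ᵥ ⇑u) := by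
    intro u v
    have e : fderiv ℝ D.cellProb θ₀ u = D.W θ₀ *ᵥ ⇑u :=
      funext fun j => D.fderiv_cellProb_apply hθ₀ u j
    rw [D.scoreMap_apply_eq β hθ₀, e, Matrix.mulVec_mulVec, J]
  obtain ⟨C, hC⟩ : ∃ C : ℝ, ∀ u : EuclideanSpace ℝ (Fin 2),
      ‖u‖ ≤ C * ‖D.scoreMap β θ₀ (fderiv ℝ D.cellProb θ₀ u)‖ := by
    set T := D.scoreMap β θ₀ ∘L fderiv ℝ D.cellProb θ₀
    have hker : T.toLinearMap.ker = ⊥ := by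
      rw [LinearMap.ker_eq_bot']
      intro u hu
      by_contra hne
      have h1 : D.scoreMap β θ₀ (fderiv ℝ D.cellProb θ₀ u) u = 0 := by
        have : T u = 0 := hu
        exact congrArg (fun f => f u) this
      have h2 := (D.posDef_J β hθ₀).dotProduct_mulVec_pos (x := ⇑u) (by
        intro h
        exact hne (by ext i; simpa using congrFun h i))
      rw [hJS] at h1
      simp only [star_trivial] at h2
      exact h2.ne' h1
    obtain ⟨K, -, hK⟩ := T.toLinearMap.exists_antilipschitzWith hker
    exact ⟨K, fun u => T.bound_of_antilipschitz hK u⟩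
  have hmain := isLittleO_of_estimating_equation (l := D.mdpdeFilter β θ₀) (θ := Prod.snd)
    (p := Prod.fst) (D.tendsto_snd_mdpdeFilter hβ hθ₀) (D.hasFDerivAt_prob hθ₀)
    (D.continuousAt_scoreMap β hθ₀) hC
    (D.eventually_mdpdeFilter.mono fun x hx => hx.2.scoreMap_eq_zero D hβ)
  have hunit : IsUnit (D.J θ₀ β).det := (D.posDef_J β hθ₀).det_pos.ne'.isUnit
  have hvec : (fun x : (Fin (D.L + 1) → ℝ) × EuclideanSpace ℝ (Fin 2) =>
      D.J θ₀ β *ᵥ ⇑(x.2 - θ₀) - S *ᵥ (x.1 - D.prob θ₀))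
      =o[D.mdpdeFilter β θ₀] fun x => x.1 - D.prob θ₀ := by
    rw [isLittleO_pi]
    intro a
    refine IsBigO.trans_isLittleO ?_ hmain
    have h := ((ContinuousLinearMap.apply ℝ ℝ (EuclideanSpace.single a (1 : ℝ) :
      EuclideanSpace ℝ (Fin 2))).isBigO_comp (fun x : (Fin (D.L + 1) → ℝ) ×
        EuclideanSpace ℝ (Fin 2) => D.scoreMap β θ₀ (fderiv ℝ D.cellProb θ₀ (x.2 - θ₀)) -
          D.scoreMap β θ₀ (x.1 - D.prob θ₀)) (D.mdpdeFilter β θ₀))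
    refine h.congr_left fun x => ?_
    rw [ContinuousLinearMap.apply_apply, sub_apply, hJS, D.scoreMap_apply_eq β hθ₀]
    simp [S]
  have hcl := ((WithLp.linearEquiv 2 ℝ (Fin 2 → ℝ)).symm.toLinearMap ∘ₗ
    (D.J θ₀ β)⁻¹.mulVecLin).toContinuousLinearMap.isBigO_comp
      (fun x : (Fin (D.L + 1) → ℝ) × EuclideanSpace ℝ (Fin 2) =>
        D.J θ₀ β *ᵥ ⇑(x.2 - θ₀) - S *ᵥ (x.1 - D.prob θ₀)) (D.mdpdeFilter β θ₀)
  refine (hcl.trans_isLittleO hvec).congr_left fun x => ?_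
  ext a
  simp only [LinearMap.coe_toContinuousLinearMap', LinearMap.comp_apply, Matrix.mulVecLin_apply,
    Matrix.mulVec_sub, Matrix.mulVec_mulVec, influence, Matrix.nonsing_inv_mul _ hunit,
    Matrix.one_mulVec]
  simp [S]

end Design

end StepStress

/-! ### Slutsky's theorem and the central limit theorem for multinomial frequencies -/

namespace StepStress

open Asymptotics
open scoped RealInnerProductSpace

/-- Second order expansion of the characteristic function of a centred discrete law. -/
lemma tendsto_sum_mul_exp_pow {m : ℕ} {w d : Fin m → ℝ} (hw : ∑ j, w j = 1)
    (hd : ∑ j, w j * d j = 0) :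
    Tendsto (fun N : ℕ => (∑ j, (w j : ℂ) * Complex.exp ((d j / √N : ℝ) * Complex.I)) ^ N) atTop
      (𝓝 (Complex.exp ((-(∑ j, w j * d j ^ 2) / 2 : ℝ)))) := by
  apply Complex.tendsto_pow_exp_of_isLittleO_sub_add_div
  have hs : Tendsto (fun N : ℕ => √(N : ℝ)) atTop atTop :=
    Real.tendsto_sqrt_atTop.comp tendsto_natCast_atTop_atTop
  have hj : ∀ j, (fun N : ℕ => (w j : ℂ) * (Complex.exp ((d j / √N : ℝ) * Complex.I) -
      ∑ i ∈ Finset.range 3, ((d j / √N : ℝ) * Complex.I) ^ i / (i.factorial : ℂ)))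
      =o[atTop] fun N : ℕ => 1 / (N : ℂ) := by
    intro j
    have h0 : Tendsto (fun N : ℕ => ((d j / √N : ℝ) * Complex.I : ℂ)) atTop (𝓝 0) := by
      have h1 : Tendsto (fun N : ℕ => d j / √N) atTop (𝓝 0) := hs.const_div_atTop _
      have h2 := ((Complex.continuous_ofReal.tendsto 0).comp h1).mul_const Complex.I
      simpa using h2
    refine IsLittleO.const_mul_left ?_ _
    refine ((Complex.exp_sub_sum_range_succ_isLittleO_pow 2).comp_tendsto h0).trans_isBigO ?_
    refine IsBigO.of_bound (d j ^ 2) (Eventually.of_forall fun N => ?_)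
    simp only [Function.comp_apply, norm_pow, norm_mul, Complex.norm_I, mul_one, Complex.norm_real,
      Real.norm_eq_abs, sq_abs, div_pow, norm_div, norm_one, Complex.norm_natCast]
    rw [Real.sq_sqrt (Nat.cast_nonneg N), mul_one_div]
  refine (IsLittleO.fun_sum (s := Finset.univ) fun j _ => hj j).congr' ?_ EventuallyEq.rfl
  filter_upwards [eventually_gt_atTop 0] with N hN
  have hN' : (0 : ℝ) < N := Nat.cast_pos.2 hN
  have hsq : ((√N : ℝ) : ℂ) ^ 2 = (N : ℂ) := by
    rw [← Complex.ofReal_pow, Real.sq_sqrt hN'.le, Complex.ofReal_natCast]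
  have hw' : ∑ j, (w j : ℂ) = 1 := by exact_mod_cast congrArg Complex.ofReal hw
  have hd' : ∑ j, (w j : ℂ) * (d j : ℂ) = 0 := by exact_mod_cast congrArg Complex.ofReal hd
  have hterm : ∀ j, (w j : ℂ) * (Complex.exp ((d j / √N : ℝ) * Complex.I) -
      ∑ i ∈ Finset.range 3, ((d j / √N : ℝ) * Complex.I) ^ i / (i.factorial : ℂ)) =
      (w j : ℂ) * Complex.exp ((d j / √N : ℝ) * Complex.I) - (w j : ℂ) -
        (w j : ℂ) * (d j : ℂ) * (Complex.I / (√N : ℝ)) +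
        (w j : ℂ) * (d j : ℂ) ^ 2 * (1 / (2 * N)) := by
    intro j
    have e : ((d j / √N : ℝ) * Complex.I : ℂ) ^ 2 = -((d j : ℂ) ^ 2 / N) := by
      rw [mul_pow, Complex.I_sq, Complex.ofReal_div, div_pow, hsq]
      ring
    simp only [Finset.sum_range_succ, Finset.sum_range_zero, zero_add, pow_zero, pow_one, e,
      Nat.factorial_zero, Nat.factorial_one, Nat.factorial_two]
    push_cast
    ring
  simp only [hterm]
  rw [Finset.sum_add_distrib, Finset.sum_sub_distrib, Finset.sum_sub_distrib, ← Finset.sum_mul,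
    ← Finset.sum_mul, hw', hd']
  push_cast
  ring

section Slutsky

variable {E : Type*} [NormedAddCommGroup E] [InnerProductSpace ℝ E] [FiniteDimensional ℝ E]
  [MeasurableSpace E] [BorelSpace E] {Ω : ℕ → Type*} [∀ N, MeasurableSpace (Ω N)]
  {P : ∀ N, Measure (Ω N)} [∀ N, IsProbabilityMeasure (P N)] {Ω' : Type*} [MeasurableSpace Ω']
  {P' : Measure Ω'} [IsProbabilityMeasure P'] {Z : Ω' → E} {X Y : ∀ N, Ω N → E}

lemma norm_exp_mul_I_sub_exp_mul_I_le (a b : ℝ) :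
    ‖Complex.exp (a * Complex.I) - Complex.exp (b * Complex.I)‖ ≤ |a - b| := by
  have e : Complex.exp (a * Complex.I) - Complex.exp (b * Complex.I) =
      Complex.exp (b * Complex.I) * (Complex.exp (Complex.I * ((a - b : ℝ) : ℂ)) - 1) := by
    rw [mul_sub, ← Complex.exp_add, mul_one]
    congr 2
    push_cast
    ring
  rw [e, norm_mul, Complex.norm_exp_ofReal_mul_I, one_mul]
  exact Real.norm_exp_I_mul_ofReal_sub_one_le

/-- Characteristic functions are close when the random vectors are close with high probability. -/
lemma norm_charFun_map_sub_le {Ω : Type*} [MeasurableSpace Ω] {P : Measure Ω}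
    [IsProbabilityMeasure P] {X Y : Ω → E} (hX : AEMeasurable X P) (hY : AEMeasurable Y P)
    {η : ℝ} (hη : 0 ≤ η) (t : E) :
    ‖charFun (P.map Y) t - charFun (P.map X) t‖ ≤
      ‖t‖ * η + 2 * P.real {ω | η < ‖Y ω - X ω‖} := by
  have hint : ∀ {V : Ω → E}, AEMeasurable V P →
      Integrable (fun ω => Complex.exp (⟪V ω, t⟫ * Complex.I)) P := fun {V} hV =>
    Integrable.of_bound (C := 1)
      (AEMeasurable.aestronglyMeasurable (by fun_prop))
      (ae_of_all _ fun ω => (Complex.norm_exp_ofReal_mul_I _).le)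
  rw [charFun_apply, charFun_apply, integral_map hY (by fun_prop), integral_map hX (by fun_prop),
    ← integral_sub (hint hY) (hint hX)]
  have hS : NullMeasurableSet {ω | η < ‖Y ω - X ω‖} P :=
    nullMeasurableSet_lt aemeasurable_const (hY.sub hX).norm
  have hind : Integrable ({ω | η < ‖Y ω - X ω‖}.indicator fun _ => (1 : ℝ)) P :=
    (integrable_const _).indicator₀ hS
  calc ‖∫ ω, Complex.exp (⟪Y ω, t⟫ * Complex.I) - Complex.exp (⟪X ω, t⟫ * Complex.I) ∂P‖
      ≤ ∫ ω, (‖t‖ * η + 2 * {ω | η < ‖Y ω - X ω‖}.indicator (fun _ => (1 : ℝ)) ω) ∂P := by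
        refine norm_integral_le_of_norm_le ((integrable_const _).add (hind.const_mul 2))
          (ae_of_all _ fun ω => ?_)
        by_cases h : η < ‖Y ω - X ω‖
        · rw [Set.indicator_of_mem (show ω ∈ {ω | η < ‖Y ω - X ω‖} from h)]
          have h1 := norm_sub_le (Complex.exp (⟪Y ω, t⟫ * Complex.I))
            (Complex.exp (⟪X ω, t⟫ * Complex.I))
          rw [Complex.norm_exp_ofReal_mul_I, Complex.norm_exp_ofReal_mul_I] at h1
          have : 0 ≤ ‖t‖ * η := by positivity
          linarith
        · rw [Set.indicator_of_notMem (show ω ∉ {ω | η < ‖Y ω - X ω‖} from h), mul_zero, add_zero]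
          refine (norm_exp_mul_I_sub_exp_mul_I_le _ _).trans ?_
          rw [← inner_sub_left, mul_comm]
          refine (abs_real_inner_le_norm _ _).trans ?_
          gcongr
          exact not_lt.1 h
    _ = ‖t‖ * η + 2 * P.real {ω | η < ‖Y ω - X ω‖} := by
        rw [integral_add (integrable_const _) (hind.const_mul 2), integral_const_mul (2 : ℝ),
          integral_indicator₀ hS]
        simp

/-- A form of Slutsky's theorem in which every random vector may live on a probability space of its
own. -/
theorem tendstoInDistribution_of_tendsto_measure_norm_sub
    (hX : TendstoInDistribution X atTop Z P P')
    (hY : ∀ N, AEMeasurable (Y N) (P N))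
    (h : ∀ η > 0, Tendsto (fun N => P N {ω | η < ‖Y N ω - X N ω‖}) atTop (𝓝 0)) :
    TendstoInDistribution Y atTop Z P P' where
  forall_aemeasurable := hY
  aemeasurable_limit := hX.aemeasurable_limit
  tendsto := by
    refine ProbabilityMeasure.tendsto_iff_tendsto_charFun.2 fun t => ?_
    have hX' := ProbabilityMeasure.tendsto_iff_tendsto_charFun.1 hX.tendsto t
    simp only [ProbabilityMeasure.coe_mk] at hX' ⊢
    have hdiff : Tendsto (fun N => charFun ((P N).map (Y N)) t - charFun ((P N).map (X N)) t)
        atTop (𝓝 0) := by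
      rw [Metric.tendsto_nhds]
      intro ε hε
      have hη : 0 < ε / (2 * (‖t‖ + 1)) := by positivity
      have hP : Tendsto (fun N => (P N).real {ω | ε / (2 * (‖t‖ + 1)) < ‖Y N ω - X N ω‖}) atTop
          (𝓝 0) := by
        simpa [Measure.real, Function.comp_def] using
          (ENNReal.tendsto_toReal ENNReal.zero_ne_top).comp (h _ hη)
      filter_upwards [hP.eventually_lt_const (show (0 : ℝ) < ε / 4 by positivity)] with N hN
      rw [dist_zero_right]
      refine (norm_charFun_map_sub_le (hX.forall_aemeasurable N) (hY N) hη.le t).trans_lt ?_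
      have : ‖t‖ * (ε / (2 * (‖t‖ + 1))) ≤ ε / 2 := by
        rw [mul_div_assoc', div_le_div_iff₀ (by positivity) (by positivity)]
        nlinarith [norm_nonneg t]
      linarith
    simpa using hdiff.add hX'

end Slutsky

namespace Design

variable (D : Design) {θ₀ : EuclideanSpace ℝ (Fin 2)}

lemma integral_countLaw (hθ₀ : θ₀ ∈ paramSpace) (N : ℕ) (f : (Fin (D.L + 1) → ℕ) → ℂ) :
    ∫ n, f n ∂D.countLaw θ₀ N =
      ∑ n ∈ Finset.piAntidiag Finset.univ N, (D.likelihood θ₀ n : ℂ) * f n := by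
  rw [countLaw, integral_finsetSum_measure fun n _ =>
    (integrable_dirac (by simp)).smul_measure ENNReal.ofReal_ne_top]
  refine Finset.sum_congr rfl fun n _ => ?_
  rw [integral_smul_measure, integral_dirac, ENNReal.toReal_ofReal, Complex.real_smul]
  exact mul_nonneg (Nat.cast_nonneg _)
    (Finset.prod_nonneg fun j _ => pow_nonneg (D.prob_pos hθ₀ j).le _)

/-- The multinomial theorem turns the characteristic function of the scaled frequencies into an
`N`-th power. -/
lemma integral_exp_countLaw (hθ₀ : θ₀ ∈ paramSpace) {N : ℕ} (hN : 0 < N)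
    (c : Fin (D.L + 1) → ℝ) :
    ∫ n, Complex.exp ((√N * ∑ j, c j * (empirical N n j - D.prob θ₀ j) : ℝ) * Complex.I)
        ∂D.countLaw θ₀ N =
      (∑ j, (D.prob θ₀ j : ℂ) *
        Complex.exp (((c j - ∑ i, D.prob θ₀ i * c i) / √N : ℝ) * Complex.I)) ^ N := by
  have hN' : (0 : ℝ) < N := Nat.cast_pos.2 hN
  have hs := Real.sqrt_pos.2 hN'
  rw [D.integral_countLaw hθ₀, Finset.sum_pow_eq_sum_piAntidiag]
  refine Finset.sum_congr rfl fun n hn => ?_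
  have hsum : ∑ j, (n j : ℝ) = N := by
    have := (Finset.mem_piAntidiag.1 hn).1
    exact_mod_cast this
  have e : √N * ∑ j, c j * (empirical N n j - D.prob θ₀ j) =
      ∑ j, (n j : ℝ) * ((c j - ∑ i, D.prob θ₀ i * c i) / √N) := by
    have e1 : ∀ j, (n j : ℝ) * ((c j - ∑ i, D.prob θ₀ i * c i) / √N) =
        √N * (c j * (n j / N)) - n j * ((∑ i, D.prob θ₀ i * c i) / √N) := by
      intro j
      have : √N / N = 1 / √N := by
        rw [div_eq_div_iff hN'.ne' hs.ne', Real.mul_self_sqrt hN'.le, one_mul]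
      have e2 : √N * (c j * (n j / N)) = c j * n j * (√N / N) := by ring
      rw [e2, this]
      ring
    have e3 : (N : ℝ) * ((∑ i, D.prob θ₀ i * c i) / √N) = √N * ∑ i, D.prob θ₀ i * c i := by
      rw [mul_div_assoc', div_eq_iff hs.ne']
      nth_rewrite 1 [← Real.mul_self_sqrt hN'.le]
      ring
    rw [Finset.sum_congr rfl fun j _ => e1 j, Finset.sum_sub_distrib, ← Finset.sum_mul, hsum, e3,
      ← Finset.mul_sum, ← mul_sub, ← Finset.sum_sub_distrib]
    congr 1
    exact Finset.sum_congr rfl fun j _ => by rw [empirical]; ring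
  rw [e, likelihood, Complex.ofReal_sum, Finset.sum_mul, Complex.exp_sum]
  push_cast
  rw [mul_assoc, ← Finset.prod_mul_distrib]
  congr 1
  refine Finset.prod_congr rfl fun j _ => ?_
  rw [mul_pow, ← Complex.exp_nat_mul]
  congr 2
  ring

/-- The covariance matrix of the cell indicators of one device. -/
noncomputable def cellCov (θ : EuclideanSpace ℝ (Fin 2)) :
    Matrix (Fin (D.L + 1)) (Fin (D.L + 1)) ℝ :=
  Matrix.diagonal (D.prob θ) - Matrix.vecMulVec (D.prob θ) (D.prob θ)

/-- The quadratic form of the covariance matrix is the variance of `c` under `π(θ₀)`. -/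
lemma dotProduct_cellCov_mulVec (hθ₀ : θ₀ ∈ paramSpace) (c : Fin (D.L + 1) → ℝ) :
    c ⬝ᵥ (D.cellCov θ₀ *ᵥ c) =
      ∑ j, D.prob θ₀ j * (c j - ∑ i, D.prob θ₀ i * c i) ^ 2 := by
  have h : ∑ j, D.prob θ₀ j * (c j - ∑ i, D.prob θ₀ i * c i) ^ 2 =
      ∑ j, D.prob θ₀ j * c j ^ 2 - (∑ i, D.prob θ₀ i * c i) ^ 2 := by
    set μ := ∑ i, D.prob θ₀ i * c i with hμ
    have e : ∀ j, D.prob θ₀ j * (c j - μ) ^ 2 =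
        D.prob θ₀ j * c j ^ 2 - D.prob θ₀ j * c j * (2 * μ) + D.prob θ₀ j * μ ^ 2 :=
      fun j => by ring
    rw [Finset.sum_congr rfl fun j _ => e j, Finset.sum_add_distrib, Finset.sum_sub_distrib,
      ← Finset.sum_mul, ← Finset.sum_mul, D.sum_prob hθ₀, ← hμ]
    ring
  rw [h, cellCov, Matrix.sub_mulVec, dotProduct_sub, Matrix.vecMulVec_mulVec]
  congr 1
  · simp only [dotProduct, Matrix.mulVec_diagonal]
    exact Finset.sum_congr rfl fun j _ => by ring
  · rw [dotProduct_smul, dotProduct_comm c]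
    simp [dotProduct, sq]

lemma posSemidef_cellCov (hθ₀ : θ₀ ∈ paramSpace) : (D.cellCov θ₀).PosSemidef := by
  refine Matrix.PosSemidef.of_dotProduct_mulVec_nonneg ?_ fun c => ?_
  · refine (Matrix.isHermitian_diagonal _).sub ?_
    ext i j
    simp [Matrix.vecMulVec_apply, mul_comm]
  · rw [star_trivial, D.dotProduct_cellCov_mulVec hθ₀]
    exact Finset.sum_nonneg fun j _ => mul_nonneg (D.prob_pos hθ₀ j).le (sq_nonneg _)

lemma posSemidef_mul_cellCov_mul {r : ℕ} (hθ₀ : θ₀ ∈ paramSpace)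
    (A : Matrix (Fin r) (Fin (D.L + 1)) ℝ) : (A * D.cellCov θ₀ * Aᵀ).PosSemidef := by
  have := (D.posSemidef_cellCov hθ₀).mul_mul_conjTranspose_same A
  rwa [Matrix.conjTranspose_eq_transpose_of_trivial] at this

variable {Ω : ℕ → Type*} [∀ N, MeasurableSpace (Ω N)] {P : ∀ N, Measure (Ω N)}
  {n : ∀ N, Ω N → Fin (D.L + 1) → ℕ}

lemma ae_sum_eq (hn : ∀ N, HasLaw (n N) (D.countLaw θ₀ N) (P N)) (N : ℕ) :
    ∀ᵐ ω ∂P N, ∑ j, n N ω j = N := by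
  have h : ∀ᵐ k ∂D.countLaw θ₀ N, ∑ j, k j = N := by
    rw [countLaw, ae_iff, Measure.finsetSum_apply]
    refine Finset.sum_eq_zero fun k hk => ?_
    rw [Measure.smul_apply, Measure.dirac_apply' _ (Set.to_countable _).measurableSet,
      Set.indicator_of_notMem, smul_zero]
    simpa using (Finset.mem_piAntidiag.1 hk).1
  exact ((hn N).ae_iff (measurable_of_countable _)).2 h

lemma charFun_map_empirical (hn : ∀ N, HasLaw (n N) (D.countLaw θ₀ N) (P N))
    {r : ℕ} (A : Matrix (Fin r) (Fin (D.L + 1)) ℝ) (N : ℕ) (t : EuclideanSpace ℝ (Fin r)) :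
    charFun ((P N).map fun ω => WithLp.toLp 2
      (A *ᵥ (√N • (empirical N (n N ω) - D.prob θ₀)))) t =
      ∫ k, Complex.exp ((√N * ∑ j, (Aᵀ *ᵥ ⇑t) j * (empirical N k j - D.prob θ₀ j) : ℝ) *
        Complex.I) ∂D.countLaw θ₀ N := by
  have hmeas : Measurable fun k : Fin (D.L + 1) → ℕ =>
      (WithLp.toLp 2 (A *ᵥ (√N • (empirical N k - D.prob θ₀))) : EuclideanSpace ℝ (Fin r)) :=
    measurable_of_countable _
  have hX : AEMeasurable (fun ω => (WithLp.toLp 2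
      (A *ᵥ (√N • (empirical N (n N ω) - D.prob θ₀))) : EuclideanSpace ℝ (Fin r))) (P N) :=
    hmeas.comp_aemeasurable (hn N).aemeasurable
  rw [← (hn N).map_eq, charFun_apply, integral_map hX (by fun_prop),
    integral_map (hn N).aemeasurable (measurable_of_countable _).aestronglyMeasurable]
  congr 1
  ext ω
  congr 3
  rw [EuclideanSpace.inner_eq_star_dotProduct, star_trivial, Matrix.mulVec_smul, dotProduct_smul,
    Matrix.dotProduct_mulVec, ← Matrix.mulVec_transpose]
  rfl

variable [∀ N, IsProbabilityMeasure (P N)]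

/-- The central limit theorem for the empirical cell frequencies and their linear images. -/
theorem tendstoInDistribution_empirical (hθ₀ : θ₀ ∈ paramSpace)
    (hn : ∀ N, HasLaw (n N) (D.countLaw θ₀ N) (P N))
    {r : ℕ} (A : Matrix (Fin r) (Fin (D.L + 1)) ℝ) :
    TendstoInDistribution (fun (N : ℕ) ω => (WithLp.toLp 2
      (A *ᵥ (√N • (empirical N (n N ω) - D.prob θ₀))) : EuclideanSpace ℝ (Fin r)))
      atTop id P (multivariateGaussian 0 (A * D.cellCov θ₀ * Aᵀ)) where
  forall_aemeasurable N :=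
    (measurable_of_countable fun k : Fin (D.L + 1) → ℕ => (WithLp.toLp 2
      (A *ᵥ (√N • (empirical N k - D.prob θ₀))) : EuclideanSpace ℝ (Fin r))).comp_aemeasurable
        (hn N).aemeasurable
  tendsto := by
    refine ProbabilityMeasure.tendsto_iff_tendsto_charFun.2 fun t => ?_
    simp only [ProbabilityMeasure.coe_mk, Measure.map_id]
    rw [charFun_multivariateGaussian (D.posSemidef_mul_cellCov_mul hθ₀ A)]
    set c := Aᵀ *ᵥ ⇑t with hc
    have hvar : ⇑t ⬝ᵥ ((A * D.cellCov θ₀ * Aᵀ) *ᵥ ⇑t) =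
        ∑ j, D.prob θ₀ j * (c j - ∑ i, D.prob θ₀ i * c i) ^ 2 := by
      rw [← D.dotProduct_cellCov_mulVec hθ₀, ← Matrix.mulVec_mulVec, ← Matrix.mulVec_mulVec, ← hc,
        Matrix.dotProduct_mulVec, ← Matrix.mulVec_transpose, ← hc]
    have hcentred : ∑ j, D.prob θ₀ j * (c j - ∑ i, D.prob θ₀ i * c i) = 0 := by
      simp only [mul_sub, Finset.sum_sub_distrib]
      rw [← Finset.sum_mul, D.sum_prob hθ₀, one_mul, sub_self]
    have hlim := tendsto_sum_mul_exp_pow (D.sum_prob hθ₀) hcentred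
    have e : Complex.exp ((⟪t, (0 : EuclideanSpace ℝ (Fin r))⟫ : ℝ) * Complex.I -
        (⇑t ⬝ᵥ ((A * D.cellCov θ₀ * Aᵀ) *ᵥ ⇑t) : ℝ) / 2) =
        Complex.exp ((-(∑ j, D.prob θ₀ j * (c j - ∑ i, D.prob θ₀ i * c i) ^ 2) / 2 : ℝ)) := by
      rw [hvar, inner_zero_right]
      congr 1
      push_cast
      ring
    rw [e]
    refine hlim.congr' ?_
    filter_upwards [eventually_gt_atTop 0] with N hN
    rw [D.charFun_map_empirical hn, D.integral_exp_countLaw hθ₀ hN]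

/-- The scaled errors of the empirical frequencies are bounded in probability. -/
lemma exists_measure_norm_empirical_le (hθ₀ : θ₀ ∈ paramSpace)
    (hn : ∀ N, HasLaw (n N) (D.countLaw θ₀ N) (P N)) {ε : ENNReal} (hε : 0 < ε) :
    ∃ M > 0, ∀ N : ℕ, P N {ω | M < √N * ‖empirical N (n N ω) - D.prob θ₀‖} ≤ ε := by
  have hclt := D.tendstoInDistribution_empirical hθ₀ hn (1 : Matrix (Fin (D.L + 1)) _ ℝ)
  have hprob : ∀ N, IsProbabilityMeasure ((P N).map fun ω => (WithLp.toLp 2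
      ((1 : Matrix (Fin (D.L + 1)) _ ℝ) *ᵥ (√N • (empirical N (n N ω) - D.prob θ₀))) :
        EuclideanSpace ℝ (Fin (D.L + 1)))) :=
    fun N => Measure.isProbabilityMeasure_map (hclt.forall_aemeasurable N)
  have htight := isTightMeasureSet_of_tendsto_charFun
    (μ := fun N => (P N).map fun ω => (WithLp.toLp 2
      ((1 : Matrix (Fin (D.L + 1)) _ ℝ) *ᵥ (√N • (empirical N (n N ω) - D.prob θ₀))) :
        EuclideanSpace ℝ (Fin (D.L + 1))))
    (f := charFun (multivariateGaussian 0
      ((1 : Matrix (Fin (D.L + 1)) _ ℝ) * D.cellCov θ₀ * (1 : Matrix _ (Fin (D.L + 1)) ℝ)ᵀ)))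
    (Continuous.continuousAt (by fun_prop))
    (fun t => by
      have := ProbabilityMeasure.tendsto_iff_tendsto_charFun.1 hclt.tendsto t
      simpa only [ProbabilityMeasure.coe_mk, Measure.map_id] using this)
  have hlim := tendsto_measure_norm_gt_of_isTightMeasureSet htight
  obtain ⟨M, hM, hMpos⟩ :=
    ((ENNReal.tendsto_nhds_zero.1 hlim ε hε).and (eventually_gt_atTop 0)).exists
  refine ⟨M, hMpos, fun N => le_trans ?_ hM⟩
  have h1 := le_iSup₂ (f := fun (μ : Measure (EuclideanSpace ℝ (Fin (D.L + 1))))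
    (_ : μ ∈ Set.range fun N : ℕ => (P N).map fun ω => (WithLp.toLp 2
      ((1 : Matrix (Fin (D.L + 1)) _ ℝ) *ᵥ (√N • (empirical N (n N ω) - D.prob θ₀))) :
        EuclideanSpace ℝ (Fin (D.L + 1)))) => μ {x | M < ‖x‖}) _ ⟨N, rfl⟩
  refine le_trans ?_ h1
  rw [Measure.map_apply_of_aemeasurable (hclt.forall_aemeasurable N)
    (measurableSet_lt measurable_const measurable_norm)]
  refine measure_mono fun ω hω => ?_
  have hle : √N * ‖empirical N (n N ω) - D.prob θ₀‖ ≤ ‖(WithLp.toLp 2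
      (√N • (empirical N (n N ω) - D.prob θ₀)) : EuclideanSpace ℝ (Fin (D.L + 1)))‖ := by
    have h2 := PiLp.lipschitzWith_ofLp 2 (fun _ : Fin (D.L + 1) => ℝ)
    have h3 := h2.norm_le_mul rfl (WithLp.toLp 2 (√N • (empirical N (n N ω) - D.prob θ₀)))
    rwa [NNReal.coe_one, one_mul, norm_smul, Real.norm_of_nonneg (Real.sqrt_nonneg _)] at h3
  simp only [Set.mem_preimage, Set.mem_ofPred_eq, Matrix.one_mulVec] at hω ⊢
  exact hω.trans_le hle

lemma empirical_mem_stdSimplex {m N : ℕ} (hN : 0 < N) {k : Fin m → ℕ} (hk : ∑ j, k j = N) :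
    empirical N k ∈ stdSimplex ℝ (Fin m) := by
  refine ⟨fun j => by unfold empirical; positivity, ?_⟩
  simp only [empirical]
  rw [← Finset.sum_div, ← Nat.cast_sum, hk, div_self (Nat.cast_pos.2 hN).ne']

/-- The weak law of large numbers: what holds for all probability vectors near `π(θ₀)` holds for
the empirical frequencies with probability tending to one. -/
lemma tendsto_measure_not_empirical (hθ₀ : θ₀ ∈ paramSpace)
    (hn : ∀ N, HasLaw (n N) (D.countLaw θ₀ N) (P N)) {Q : (Fin (D.L + 1) → ℝ) → Prop}
    (hQ : ∀ᶠ p in 𝓝 (D.prob θ₀), p ∈ stdSimplex ℝ (Fin (D.L + 1)) → Q p) :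
    Tendsto (fun N => P N {ω | ¬Q (empirical N (n N ω))}) atTop (𝓝 0) := by
  obtain ⟨δ, hδ, hball⟩ := Metric.eventually_nhds_iff.1 hQ
  refine ENNReal.tendsto_nhds_zero.2 fun ε hε => ?_
  obtain ⟨M, -, hM⟩ := D.exists_measure_norm_empirical_le hθ₀ hn hε
  have hs : Tendsto (fun N : ℕ => √(N : ℝ) * δ) atTop atTop :=
    (Real.tendsto_sqrt_atTop.comp tendsto_natCast_atTop_atTop).atTop_mul_const hδ
  filter_upwards [hs.eventually_gt_atTop M, eventually_gt_atTop 0] with N hN hN0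
  refine le_trans (measure_mono_ae ?_) (hM N)
  filter_upwards [D.ae_sum_eq hn N] with ω hω hnot
  refine hN.trans_le (mul_le_mul_of_nonneg_left ?_ (Real.sqrt_nonneg _))
  by_contra! hlt
  exact hnot (hball (by rwa [dist_eq_norm]) (empirical_mem_stdSimplex hN0 hω))

lemma tendsto_measure_empirical (hθ₀ : θ₀ ∈ paramSpace)
    (hn : ∀ N, HasLaw (n N) (D.countLaw θ₀ N) (P N)) {Q : (Fin (D.L + 1) → ℝ) → Prop}
    (hQ : ∀ᶠ p in 𝓝 (D.prob θ₀), p ∈ stdSimplex ℝ (Fin (D.L + 1)) → Q p) :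
    Tendsto (fun N => P N {ω | Q (empirical N (n N ω))}) atTop (𝓝 1) := by
  have h := ENNReal.Tendsto.sub (tendsto_const_nhds (x := (1 : ENNReal)))
    (D.tendsto_measure_not_empirical hθ₀ hn hQ) (Or.inl ENNReal.one_ne_top)
  rw [tsub_zero] at h
  refine tendsto_of_tendsto_of_tendsto_of_le_of_le h tendsto_const_nhds (fun N => ?_)
    fun N => prob_le_one
  refine tsub_le_iff_right.2 ?_
  rw [← measure_univ (μ := P N)]
  refine (measure_mono fun ω _ => ?_).trans (measure_union_le _ _)
  exact em _

end Design

end StepStress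

/-! ### Asymptotic normality and maximum likelihood -/

namespace StepStress

namespace Design

variable (D : Design) {θ θ₀ : EuclideanSpace ℝ (Fin 2)} {β : ℝ}

/-- The sandwich form of the limiting covariance. -/
lemma influence_mul_cellCov_mul (β : ℝ) (hθ : θ ∈ paramSpace) :
    D.influence β θ * D.cellCov θ * (D.influence β θ)ᵀ =
      (D.J θ β)⁻¹ * D.K θ β * (D.J θ β)⁻¹ := by
  have hsymm : (D.J θ β)ᵀ = D.J θ β := by
    have := (D.posDef_J β hθ).1.eq
    rwa [Matrix.conjTranspose_eq_transpose_of_trivial] at this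
  have hmid : Matrix.diagonal (fun j => D.prob θ j ^ (β - 1)) * D.cellCov θ *
      Matrix.diagonal (fun j => D.prob θ j ^ (β - 1)) =
      Matrix.diagonal (fun j => D.prob θ j ^ (2 * β - 1)) -
        Matrix.vecMulVec (fun j => D.prob θ j ^ β) (fun j => D.prob θ j ^ β) := by
    have e1 : ∀ j, D.prob θ j ^ (β - 1) * D.prob θ j = D.prob θ j ^ β := fun j => by
      rw [← Real.rpow_add_one (D.prob_pos hθ j).ne', sub_add_cancel]
    have e2 : ∀ j, D.prob θ j ^ β * D.prob θ j ^ (β - 1) = D.prob θ j ^ (2 * β - 1) := fun j => by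
      rw [← Real.rpow_add (D.prob_pos hθ j)]
      congr 1
      ring
    ext i j
    rw [Matrix.mul_diagonal, Matrix.diagonal_mul, cellCov, Matrix.sub_apply, Matrix.sub_apply,
      Matrix.vecMulVec_apply, Matrix.vecMulVec_apply, mul_sub, sub_mul]
    congr 1
    · rcases eq_or_ne i j with rfl | hij
      · rw [Matrix.diagonal_apply_eq, Matrix.diagonal_apply_eq, e1, e2]
      · rw [Matrix.diagonal_apply_ne _ hij, Matrix.diagonal_apply_ne _ hij, mul_zero, zero_mul]
    · rw [← e1 i, ← e1 j]
      ring
  rw [K, ← hmid, influence, Matrix.transpose_mul, Matrix.transpose_mul, Matrix.transpose_transpose,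
    Matrix.transpose_nonsing_inv, hsymm, Matrix.diagonal_transpose]
  simp only [Matrix.mul_assoc]

lemma J_zero (θ : EuclideanSpace ℝ (Fin 2)) :
    D.J θ 0 = (D.W θ)ᵀ * Matrix.diagonal (fun j => (D.prob θ j)⁻¹) * D.W θ := by
  simp only [J, zero_sub, Real.rpow_neg_one]

/-- The rank one term of `K_0` drops out because the columns of `W` sum to zero. -/
lemma K_zero_eq_J_zero (θ : EuclideanSpace ℝ (Fin 2)) : D.K θ 0 = D.J θ 0 := by
  have h : (D.W θ)ᵀ * Matrix.vecMulVec (fun j => D.prob θ j ^ (0 : ℝ))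
      (fun j => D.prob θ j ^ (0 : ℝ)) = 0 := by
    ext a j
    simp [Matrix.mul_apply, Matrix.vecMulVec_apply, D.sum_W]
  rw [K, J, Matrix.mul_sub, h, sub_zero, mul_zero]

lemma score_eq (hθ : θ ∈ paramSpace) (j : Fin (D.L + 1)) (a : Fin 2) :
    D.score θ j a = (D.prob θ j)⁻¹ * D.W θ j a := by
  have h := (hasFDerivAt_pi'.1 (D.hasFDerivAt_prob hθ) j).log (D.prob_pos hθ j).ne'
  rw [score, h.fderiv]
  simp [D.fderiv_cellProb_apply hθ]

lemma fisherInformation_eq (hθ : θ ∈ paramSpace) :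
    D.fisherInformation θ =
      (D.W θ)ᵀ * Matrix.diagonal (fun j => (D.prob θ j)⁻¹) * D.W θ := by
  ext a b
  rw [fisherInformation, Matrix.sum_apply, Matrix.mul_apply]
  refine Finset.sum_congr rfl fun j _ => ?_
  rw [Matrix.smul_apply, Matrix.vecMulVec_apply, D.score_eq hθ, D.score_eq hθ,
    Matrix.mul_diagonal, Matrix.transpose_apply, smul_eq_mul]
  have := (D.prob_pos hθ j).ne'
  field_simp

/-- Maximizing the likelihood is minimizing the Kullback-Leibler divergence from the empirical
frequencies: the logarithm of the likelihood is an affine, decreasing function of it. -/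
lemma isMLE_iff {N : ℕ} (hN : 0 < N) (k : Fin (D.L + 1) → ℕ) :
    D.IsMLE k θ ↔ D.IsMDPDE 0 (empirical N k) θ := by
  have hN' : (0 : ℝ) < N := Nat.cast_pos.2 hN
  have hpos : ∀ η ∈ paramSpace, 0 < D.likelihood η k := fun η hη =>
    mul_pos (Nat.cast_pos.2 (Nat.multinomial_pos _ _))
      (Finset.prod_pos fun j _ => pow_pos (D.prob_pos hη j) _)
  have hdpd : ∀ η ∈ paramSpace, N * dpd 0 (empirical N k) (D.prob η) =
      (∑ j, k j * Real.log (k j / N) + Real.log (Nat.multinomial Finset.univ k)) -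
        Real.log (D.likelihood η k) := by
    intro η hη
    rw [likelihood, Real.log_mul (Nat.cast_ne_zero.2 (Nat.multinomial_pos _ _).ne')
      (Finset.prod_pos fun j _ => pow_pos (D.prob_pos hη j) _).ne',
      Real.log_prod fun j _ => (pow_pos (D.prob_pos hη j) _).ne', dpd, if_pos rfl,
      Finset.mul_sum, add_comm (Real.log _), add_sub_add_right_eq_sub, ← Finset.sum_sub_distrib]
    refine Finset.sum_congr rfl fun j _ => ?_
    rw [empirical, Real.log_pow]
    rcases Nat.eq_zero_or_pos (k j) with h0 | h0
    -- `0 * log 0 = 0` makes empty cells harmless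
    · simp [h0]
    · have h0' : (0 : ℝ) < k j := Nat.cast_pos.2 h0
      rw [Real.log_div (div_pos h0' hN').ne' (D.prob_pos hη j).ne']
      field_simp
  refine and_congr_right fun hθ => forall₂_congr fun η hη => ?_
  show D.likelihood η k ≤ D.likelihood θ k ↔
    dpd 0 (empirical N k) (D.prob θ) ≤ dpd 0 (empirical N k) (D.prob η)
  rw [← Real.log_le_log_iff (hpos η hη) (hpos θ hθ), ← mul_le_mul_iff_right₀ (c := dpd 0 _ _) hN',
    hdpd η hη, hdpd θ hθ, sub_le_sub_iff_left]

variable {Ω : ℕ → Type*} [∀ N, MeasurableSpace (Ω N)] {P : ∀ N, Measure (Ω N)}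
  [∀ N, IsProbabilityMeasure (P N)] {n : ∀ N, Ω N → Fin (D.L + 1) → ℕ}

/-- Asymptotic normality of the minimum divergence estimators, by the delta method. -/
theorem tendstoInDistribution_mdpde (hβ : 0 ≤ β) (hθ₀ : θ₀ ∈ paramSpace)
    (hn : ∀ N, HasLaw (n N) (D.countLaw θ₀ N) (P N))
    {θhat : ∀ N, Ω N → EuclideanSpace ℝ (Fin 2)} (hmeas : ∀ N, AEMeasurable (θhat N) (P N))
    (hmin : ∀ᶠ N in atTop, ∀ᵐ ω ∂(P N), (∃ θ, D.IsMDPDE β (empirical N (n N ω)) θ) →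
      D.IsMDPDE β (empirical N (n N ω)) (θhat N ω)) :
    TendstoInDistribution (fun (N : ℕ) ω => √(N : ℝ) • (θhat N ω - θ₀)) atTop id P
      (multivariateGaussian 0 ((D.J θ₀ β)⁻¹ * D.K θ₀ β * (D.J θ₀ β)⁻¹)) := by
  have hclt := D.tendstoInDistribution_empirical hθ₀ hn (D.influence β θ₀)
  rw [D.influence_mul_cellCov_mul β hθ₀] at hclt
  refine tendstoInDistribution_of_tendsto_measure_norm_sub hclt
    (fun N => ((hmeas N).sub_const θ₀).fun_const_smul _) fun η hη => ?_
  refine ENNReal.tendsto_nhds_zero.2 fun ε hε => ?_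
  have hε2 : 0 < ε / 2 := ENNReal.half_pos hε.ne'
  obtain ⟨M, hMpos, hM⟩ := D.exists_measure_norm_empirical_le hθ₀ hn hε2
  have hsmall := (D.isLittleO_mdpde hβ hθ₀).bound (div_pos hη hMpos)
  rw [mdpdeFilter, eventually_inf_principal, eventually_comap] at hsmall
  have hQ : ∀ᶠ p in 𝓝 (D.prob θ₀), p ∈ stdSimplex ℝ (Fin (D.L + 1)) →
      (∃ θ, D.IsMDPDE β p θ) ∧ ∀ θ, D.IsMDPDE β p θ →
        ‖θ - θ₀ - WithLp.toLp 2 (D.influence β θ₀ *ᵥ (p - D.prob θ₀))‖ ≤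
          η / M * ‖p - D.prob θ₀‖ := by
    filter_upwards [hsmall, D.eventually_exists_isMDPDE hβ hθ₀] with p hp hex hps
    exact ⟨hex hps, fun θ hθ => hp (p, θ) rfl ⟨hps, hθ⟩⟩
  filter_upwards [ENNReal.tendsto_nhds_zero.1 (D.tendsto_measure_not_empirical hθ₀ hn hQ) _ hε2,
    hmin] with N hN hminN
  calc P N {ω | η < ‖√N • (θhat N ω - θ₀) - WithLp.toLp 2
        (D.influence β θ₀ *ᵥ (√N • (empirical N (n N ω) - D.prob θ₀)))‖}
      ≤ P N ({ω | ¬((∃ θ, D.IsMDPDE β (empirical N (n N ω)) θ) ∧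
          ∀ θ, D.IsMDPDE β (empirical N (n N ω)) θ →
            ‖θ - θ₀ - WithLp.toLp 2 (D.influence β θ₀ *ᵥ (empirical N (n N ω) - D.prob θ₀))‖ ≤
              η / M * ‖empirical N (n N ω) - D.prob θ₀‖)} ∪
          {ω | M < √N * ‖empirical N (n N ω) - D.prob θ₀‖}) := by
        refine measure_mono_ae ?_
        filter_upwards [hminN] with ω hω hlt
        by_contra hnot
        have hnot' := not_or.1 hnot
        have hgood := not_not.1 hnot'.1
        have hle : √N * ‖empirical N (n N ω) - D.prob θ₀‖ ≤ M := not_lt.1 hnot'.2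
        have hR := hgood.2 _ (hω hgood.1)
        replace hlt : η < ‖√N • (θhat N ω - θ₀) - WithLp.toLp 2
          (D.influence β θ₀ *ᵥ (√N • (empirical N (n N ω) - D.prob θ₀)))‖ := hlt
        rw [Matrix.mulVec_smul, WithLp.toLp_smul, ← smul_sub, norm_smul,
          Real.norm_of_nonneg (Real.sqrt_nonneg _)] at hlt
        refine absurd hlt (not_lt.2 ?_)
        calc √N * ‖θhat N ω - θ₀ - WithLp.toLp 2
              (D.influence β θ₀ *ᵥ (empirical N (n N ω) - D.prob θ₀))‖
            ≤ √N * (η / M * ‖empirical N (n N ω) - D.prob θ₀‖) := by gcongr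
          _ = η / M * (√N * ‖empirical N (n N ω) - D.prob θ₀‖) := by ring
          _ ≤ η / M * M := by gcongr
          _ = η := div_mul_cancel₀ _ hMpos.ne'
    _ ≤ ε / 2 + ε / 2 := (measure_union_le _ _).trans (add_le_add hN (hM N))
    _ = ε := ENNReal.add_halves ε

end Design

end StepStress

theorem theorem3 (D : Design) (θ₀ : EuclideanSpace ℝ (Fin 2)) (hθ₀ : θ₀ ∈ paramSpace)
    {Ω : ℕ → Type*} [∀ N, MeasurableSpace (Ω N)] (P : ∀ N, Measure (Ω N))
    [∀ N, IsProbabilityMeasure (P N)]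
    (n : ∀ N, Ω N → Fin (D.L + 1) → ℕ)
    (hn : ∀ N, HasLaw (n N) (D.countLaw θ₀ N) (P N)) :
    (∀ β : ℝ, 0 ≤ β →
      IsUnit (D.J θ₀ β).det ∧
      ((D.J θ₀ β)⁻¹ * D.K θ₀ β * (D.J θ₀ β)⁻¹).PosSemidef ∧
      Tendsto (fun N => P N {ω | ∃ θ, D.IsMDPDE β (empirical N (n N ω)) θ}) atTop (𝓝 1) ∧
      ∀ θhat : ∀ N, Ω N → EuclideanSpace ℝ (Fin 2),
        (∀ N, AEMeasurable (θhat N) (P N)) →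
        (∀ N, ∀ᵐ ω ∂(P N), (∃ θ, D.IsMDPDE β (empirical N (n N ω)) θ) →
          D.IsMDPDE β (empirical N (n N ω)) (θhat N ω)) →
        TendstoInDistribution (fun (N : ℕ) ω => √(N : ℝ) • (θhat N ω - θ₀)) atTop id P
          (multivariateGaussian 0 ((D.J θ₀ β)⁻¹ * D.K θ₀ β * (D.J θ₀ β)⁻¹))) ∧
    D.J θ₀ 0 = D.fisherInformation θ₀ ∧
    D.K θ₀ 0 = D.fisherInformation θ₀ ∧
    D.fisherInformation θ₀ =
      (D.W θ₀)ᵀ * Matrix.diagonal (fun j => (D.prob θ₀ j)⁻¹) * D.W θ₀ ∧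
    Tendsto (fun N => P N {ω | ∃ θ, D.IsMLE (n N ω) θ}) atTop (𝓝 1) ∧
    ∀ θhat : ∀ N, Ω N → EuclideanSpace ℝ (Fin 2),
      (∀ N, AEMeasurable (θhat N) (P N)) →
      (∀ N, ∀ᵐ ω ∂(P N), (∃ θ, D.IsMLE (n N ω) θ) → D.IsMLE (n N ω) (θhat N ω)) →
      TendstoInDistribution (fun (N : ℕ) ω => √(N : ℝ) • (θhat N ω - θ₀)) atTop id P
        (multivariateGaussian 0 (D.fisherInformation θ₀)⁻¹) := by
  have hunit : ∀ β, IsUnit (D.J θ₀ β).det := fun β => (D.posDef_J β hθ₀).det_pos.ne'.isUnit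
  have hexists : ∀ β : ℝ, 0 ≤ β →
      Tendsto (fun N => P N {ω | ∃ θ, D.IsMDPDE β (empirical N (n N ω)) θ}) atTop (𝓝 1) :=
    fun β hβ => D.tendsto_measure_empirical hθ₀ hn (D.eventually_exists_isMDPDE hβ hθ₀)
  have hfisher := D.fisherInformation_eq hθ₀
  have hJ : D.J θ₀ 0 = D.fisherInformation θ₀ := (D.J_zero θ₀).trans hfisher.symm
  have hK : D.K θ₀ 0 = D.fisherInformation θ₀ := (D.K_zero_eq_J_zero θ₀).trans hJ
  refine ⟨fun β hβ => ⟨hunit β, ?_, hexists β hβ, fun θhat hmeas hmin =>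
    D.tendstoInDistribution_mdpde hβ hθ₀ hn hmeas (Eventually.of_forall hmin)⟩,
    hJ, hK, hfisher, ?_, fun θhat hmeas hmax => ?_⟩
  · rw [← D.influence_mul_cellCov_mul β hθ₀]
    exact D.posSemidef_mul_cellCov_mul hθ₀ _
  · refine (hexists 0 le_rfl).congr' ?_
    filter_upwards [eventually_gt_atTop 0] with N hN
    simp only [D.isMLE_iff hN]
  · have hcov : (D.J θ₀ 0)⁻¹ * D.K θ₀ 0 * (D.J θ₀ 0)⁻¹ = (D.fisherInformation θ₀)⁻¹ := by
      rw [hK, ← hJ, Matrix.nonsing_inv_mul _ (hunit 0), one_mul]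
    rw [← hcov]
    refine D.tendstoInDistribution_mdpde le_rfl hθ₀ hn hmeas ?_
    filter_upwards [eventually_gt_atTop 0] with N hN
    simpa only [D.isMLE_iff hN] using hmax N
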